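/- Let $\mathbb{Z}_2$ be the compact group of dyadic integers with the adding machine $T(x)=x+1$. For $a\in C(\mathbb{Z}_2,\mathbb{C})$ let $L=L^a$ be the almost periodic Jacobi operator given on the fibre over $x\in\mathbb{Z}_2$ by $$(L_x u)_n = a(x+n)\,u_{n+1}+a(x+n-1)\,u_{n-1},\qquad u\in\ell^2(\mathbb{Z}).$$ For $c\in\mathbb{C}$, a Jacobi operator $D=L^d$ is called a renormalization of $L=L^a$ at energy $c$, written $D=\phi_c(L)$, if for every $x$ the operator $D_{2x}^2+c$, restricted to its invariant subspace $\ell^2(2\mathbb{Z})\cong\ell^2(\mathbb{Z})$, equals $L_x$, and $D$ lies on a chosen one of two branches. On the unstable branch, $d(2x)\neq 0$ for all $x$ and there are $K$ and $0<\rho<1$ with $$\prod_{k<N}|d(2(x+k)+1)|\le K\rho^N\prod_{k<N}|d(2(x+k))|\qquad\text{for all } x\in\mathbb{Z}_2,\ N\ge 0.$$ On the stable branch the same holds with the roles of $d(2\,\cdot)$ and $d(2\,\cdot+1)$ exchanged. (That is, the solutions of $L_xv=cv$ which are formally annihilated by $D_{2x}$ decay exponentially at $-\infty$, respectively at $+\infty$,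 so that $d$ comes from the unstable, respectively the stable, Titchmarsh-Weyl function of $L$ at energy $c$.) The operator $\phi_c(L)$ is determined up to the signs of the square roots. We say that the iterates of $\phi_c$ converge to a bounded operator if there are a Jacobi operator $D=L^d$, $d\in C(\mathbb{Z}_2,\mathbb{C})$, and a neighbourhood $U$ of $D$ (in the sup norm of the coefficients) such that for all $L\in U$ all the iterates $\phi_c^n(L)$, $n\ge0$, exist and, with a suitable choice of signs, $\phi_c^n(L)\to D$ in the operator norm, uniformly in $L\in U$ and in the fibres $x\in\mathbb{Z}_2$. The Jacobi Mandelbrot set $JM\subset\mathbb{C}$ is the complement of the set of those $c\in\mathbb{C}$ for which the iterates of $\phi_c$ converge to a bounded operator. Theorem. For each of the two branches, $JM$ contains the standard Mandelbrot set $M=\{c\in\mathbb{C} : \text{the orbit of } 0 \text{ under } z\mapsto z^2+c \text{ is bounded}\}$, so $M\subset JM\subset\mathbb{C}$, and $JM$ is compact. -/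

import Mathlib

open Filter Topology
open scoped ENNReal

noncomputable section

/-- The standard Mandelbrot set: the parameters `c` for which the orbit of `0` under
`z ↦ z ^ 2 + c` stays bounded. -/
def mandelbrotSet : Set ℂ :=
  {c | Bornology.IsBounded (Set.range fun n : ℕ => (fun z : ℂ => z ^ 2 + c)^[n] 0)}

/-- The Hilbert space `ℓ²(ℤ)`. -/
abbrev EllTwo : Type := lp (fun _ : ℤ => ℂ) 2

theorem memℓp_two_of_norm_le {u : ℤ → ℂ} (v : EllTwo) (f : ℤ → ℤ) (hf : Function.Injective f)
    (K : ℝ) (h : ∀ n, ‖u n‖ ≤ K * ‖v (f n)‖) : Memℓp u 2 := by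
  have hv : Summable fun n => ‖v n‖ ^ (2 : ℝ) := by
    simpa using (lp.memℓp v).summable (by norm_num)
  refine memℓp_gen ?_
  have h2 : Summable fun n => K ^ 2 * ‖v (f n)‖ ^ (2 : ℝ) :=
    (hv.comp_injective hf).mul_left _
  refine Summable.of_nonneg_of_le (fun n => by positivity) (fun n => ?_) h2
  have h3 : ‖u n‖ ^ 2 ≤ (K * ‖v (f n)‖) ^ 2 := by gcongr; exact h n
  simpa [mul_pow] using h3

theorem norm_le_of_norm_apply_le (u v : EllTwo) (f : ℤ → ℤ) (hf : Function.Injective f)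
    (K : ℝ) (hK : 0 ≤ K) (h : ∀ n, ‖u n‖ ≤ K * ‖v (f n)‖) : ‖u‖ ≤ K * ‖v‖ := by
  have hv : Summable fun n => ‖v n‖ ^ (2 : ℝ) := by
    simpa using (lp.memℓp v).summable (by norm_num)
  have hu : Summable fun n => ‖u n‖ ^ (2 : ℝ) := by
    simpa using (lp.memℓp u).summable (by norm_num)
  have eu : ‖u‖ ^ (2 : ℝ) = ∑' n, ‖u n‖ ^ (2 : ℝ) := by
    simpa using lp.norm_rpow_eq_tsum (p := 2) (by norm_num) u
  have ev : ‖v‖ ^ (2 : ℝ) = ∑' n, ‖v n‖ ^ (2 : ℝ) := by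
    simpa using lp.norm_rpow_eq_tsum (p := 2) (by norm_num) v
  have h1 : ∑' n, ‖u n‖ ^ (2 : ℝ) ≤ ∑' n, K ^ 2 * ‖v (f n)‖ ^ (2 : ℝ) := by
    refine hu.tsum_le_tsum (fun n => ?_) ((hv.comp_injective hf).mul_left _)
    have h3 : ‖u n‖ ^ 2 ≤ (K * ‖v (f n)‖) ^ 2 := by gcongr; exact h n
    simpa [mul_pow] using h3
  have h2 : ∑' n, ‖v (f n)‖ ^ (2 : ℝ) ≤ ∑' n, ‖v n‖ ^ (2 : ℝ) :=
    tsum_comp_le_tsum_of_inj hv (fun n => by positivity) hf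
  rw [tsum_mul_left] at h1
  have h4 : ‖u‖ ^ (2 : ℝ) ≤ K ^ 2 * ‖v‖ ^ (2 : ℝ) := by
    rw [eu, ev]; exact h1.trans (by gcongr)
  have h5 : ‖u‖ ^ 2 ≤ (K * ‖v‖) ^ 2 := by
    simpa [mul_pow] using h4
  exact le_of_sq_le_sq h5 (by positivity)

/-- For an injective `f : ℤ → ℤ`, the bounded operator `u ↦ u ∘ f` on `ℓ²(ℤ)`. -/
def pullback (f : ℤ → ℤ) (hf : Function.Injective f) : EllTwo →L[ℂ] EllTwo :=
  LinearMap.mkContinuous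
    { toFun := fun u =>
        ⟨fun n => u (f n), memℓp_two_of_norm_le u f hf 1 fun n => by simp⟩
      map_add' := fun _ _ => rfl
      map_smul' := fun _ _ => rfl } 1
    (fun u => norm_le_of_norm_apply_le _ u f hf 1 zero_le_one fun n => (one_mul ‖u (f n)‖).ge)

/-- The translation `(τᵐ u)(n) = u(n + m)` on `ℓ²(ℤ)`. -/
def translation (m : ℤ) : EllTwo →L[ℂ] EllTwo :=
  pullback (fun n => n + m) (add_left_injective m)

/-- The restriction of a sequence to the even sublattice `2ℤ`, which is identified
with `ℤ`: `(restrictEven u)(n) = u(2n)`. -/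
def restrictEven : EllTwo →L[ℂ] EllTwo :=
  pullback (fun n => 2 * n) (mul_right_injective₀ two_ne_zero)

/-- Multiplication by the sequence `n ↦ a(Tⁿ x) = a(x + n)`, where `T x = x + 1` is the
adding machine on the compact group `ℤ_[2]` of dyadic integers. -/
def samplingMul (a : C(ℤ_[2], ℂ)) (x : ℤ_[2]) : EllTwo →L[ℂ] EllTwo :=
  LinearMap.mkContinuous
    { toFun := fun u =>
        ⟨fun n => a (x + n) * u n,
          memℓp_two_of_norm_le u id Function.injective_id ‖a‖ fun n => by
            rw [norm_mul]; gcongr; exacts [a.norm_coe_le_norm _, le_rfl]⟩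
      map_add' := fun u v => by ext n; exact mul_add _ _ _
      map_smul' := fun k u => by ext n; exact mul_left_comm _ _ _ } ‖a‖
    (fun u => norm_le_of_norm_apply_le _ u id Function.injective_id ‖a‖ (norm_nonneg _)
      fun n => by
        change ‖a (x + n) * u n‖ ≤ _
        rw [norm_mul]; gcongr; exacts [a.norm_coe_le_norm _, le_rfl])

/-- The almost periodic Jacobi operator over the adding machine with coefficient
`a ∈ C(ℤ_[2])`, in the fibre over `x`:
`(L_x u)(n) = a(x + n) u(n + 1) + a(x + n - 1) u(n - 1)` on `ℓ²(ℤ)`.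
For real `a` this is `aτ + (aτ)*`; for complex `a` it is complex symmetric. -/
def jacobi (a : C(ℤ_[2], ℂ)) (x : ℤ_[2]) : EllTwo →L[ℂ] EllTwo :=
  samplingMul a x ∘L translation 1 + translation (-1) ∘L samplingMul a x

theorem jacobi_apply (a : C(ℤ_[2], ℂ)) (x : ℤ_[2]) (u : EllTwo) (n : ℤ) :
    jacobi a x u n = a (x + n) * u (n + 1) + a (x + n - 1) * u (n - 1) := by
  change a (x + n) * u (n + 1) + a (x + ((n + -1 : ℤ) : ℤ_[2])) * u (n + -1) = _
  push_cast
  rw [← sub_eq_add_neg, ← sub_eq_add_neg, add_sub_assoc]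

/-- The two branches of the square root, given by the two Titchmarsh-Weyl functions. -/
inductive WeylBranch : Type
  | unstable
  | stable

/-- Let `D` be the Jacobi operator with coefficient `d`. The sequences `v` on the even
sublattice that are (formally) annihilated by `D` in the fibre over `2x` satisfy
`d(2(x+k)) v(k) + d(2(x+k)+1) v(k+1) = 0`; if `D ^ 2 + c = L` on the even sublattice, they
solve `L v = c v`. The coefficient `d` belongs to the unstable branch if these solutions
decay exponentially at `-∞`, and to the stable one if they decay exponentially at `+∞`,
uniformly in the base point, so that the solutions span the unstable, respectively stable,
direction of the hyperbolic transfer cocycle of `L` at energy `c`. -/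
def IsWeylBranch (s : WeylBranch) (d : C(ℤ_[2], ℂ)) : Prop :=
  match s with
  | .unstable => (∀ x, d (2 * x) ≠ 0) ∧ ∃ K ρ : ℝ, 0 < ρ ∧ ρ < 1 ∧ ∀ (x : ℤ_[2]) (N : ℕ),
      ∏ k ∈ Finset.range N, ‖d (2 * (x + k) + 1)‖
        ≤ K * ρ ^ N * ∏ k ∈ Finset.range N, ‖d (2 * (x + k))‖
  | .stable => (∀ x, d (2 * x + 1) ≠ 0) ∧ ∃ K ρ : ℝ, 0 < ρ ∧ ρ < 1 ∧ ∀ (x : ℤ_[2]) (N : ℕ),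
      ∏ k ∈ Finset.range N, ‖d (2 * (x + k))‖
        ≤ K * ρ ^ N * ∏ k ∈ Finset.range N, ‖d (2 * (x + k) + 1)‖

/-- `D = φ(L)`, where `L`, `D` are the Jacobi operators with coefficients `a`, `d`: the
operator `D` lies on the branch `s` and `D ^ 2 + c = L`. The 2:1 integral extension of the
adding machine is again the adding machine, the base point `x` of `L` corresponding to the
base point `2x` of `D`; `D ^ 2` leaves the even sublattice invariant, and there
`D ^ 2 + c` is to be `L`. For given `L` this fixes the function `d ^ 2`, so that `φ(L)` is
determined up to the signs of the square roots. -/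
def IsRenormalization (s : WeylBranch) (c : ℂ) (a d : C(ℤ_[2], ℂ)) : Prop :=
  IsWeylBranch s d ∧ ∀ x : ℤ_[2],
    restrictEven ∘L (jacobi d (2 * x) ∘L jacobi d (2 * x) + c • ContinuousLinearMap.id ℂ EllTwo)
      = jacobi a x ∘L restrictEven

/-- The iterates of the renormalization map at energy `c` converge to a bounded operator:
there are a Jacobi operator `D` and a neighbourhood `U` of `D` such that for `L` in `U` all
iterates `φⁿ(L)` exist (`Φ n a` is the coefficient of `φⁿ(L)`, if `a` is the one of `L`) and
converge to `D` in the operator norm, uniformly in `L` and in the fibres `x`. -/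
def RenormalizationConverges (s : WeylBranch) (c : ℂ) : Prop :=
  ∃ d : C(ℤ_[2], ℂ), ∃ U ∈ 𝓝 d, ∃ Φ : ℕ → C(ℤ_[2], ℂ) → C(ℤ_[2], ℂ),
    (∀ a ∈ U, Φ 0 a = a ∧ ∀ n, IsRenormalization s c (Φ n a) (Φ (n + 1) a)) ∧
    TendstoUniformlyOn (fun (n : ℕ) (p : C(ℤ_[2], ℂ) × ℤ_[2]) => jacobi (Φ n p.1) p.2)
      (fun p => jacobi d p.2) atTop (U ×ˢ Set.univ)

/-- The Jacobi Mandelbrot set (for the branch `s` of the renormalization map). -/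
def jacobiMandelbrotSet (s : WeylBranch) : Set ℂ :=
  {c | ¬ RenormalizationConverges s c}

end

noncomputable section

/-! Comparing matrix entries turns the renormalization equation into `d(2x) d(2x+1) = a(x)` and
`d(2x)^2 + d(2x-1)^2 = -c` (`restrictEven_sq_eq_iff`). Eliminating the odd values, `e = d(2·)`
satisfies a Riccati equation in which `e^2` is an invariant section of `y ↦ -c - a^2 / y` over the
adding machine. The fibre derivative of this map has modulus `‖a‖^2 / ‖e‖^4 = (‖d(2x+1)‖ /
‖d(2x)‖)^2`, so the unstable branch condition says exactly that the section attracts. Such a section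
is unique (`IsUnstableSection.sq_unique`) and, by the implicit function theorem, depends smoothly on
energy and coefficient (`IsUnstableSection.exists_local`). The reflection `x ↦ -1 - x` exchanges
even and odd points, so the stable branch reduces to the unstable one.

Boundedness: scaling normalizes a large energy to `-1` and turns the renormalization map into a
small perturbation of a constant map, whose fixed point is superattracting.

Openness: where the iterates converge uniformly near `d`, Cauchy's estimate forces a power of the
derivative at `d` to have norm less than one (`norm_pow_fderiv_lt_one`), and such a fixed point
persists for nearby `c` (`eventually_exists_attracting_fixedPoint`). The signs chosen by the given
iterates may be discontinuous, so these must first be compared with a smooth branch of the map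
(`exists_ball_iterate_stepMap`).

Containment of `M`: if `d` is a fixed point and `b = d^2` along `0, 1, 2, …`, the orthogonal
polynomials of `b`, with the first entry replaced by `-c`, satisfy `P_{2n}(z) = P_n(z^2 + c)`, so
`P_{2^n}(c)` is the orbit of `c`. The same numbers are products of the values `-b(2k)`. Since `∏
b(k)` over `k < 2^n` equals `b 0`, contraction forces `∏ ‖b(2k)‖`, hence the orbit, to infinity
(`IsFixedSequence.iterate_mul`). For `c = 0` a telescoping product contradicts contraction directly.
-/

/-- The Banach algebra of coefficients `C(ℤ_[2], ℂ)`. -/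
abbrev Coeff : Type := C(ℤ_[2], ℂ)

/-! ### Coefficients on the dyadic integers: parity and reflection. -/

/-- Precomposition with a continuous self-map of the dyadic integers. -/
def pullbackCoeff (φ : C(ℤ_[2], ℤ_[2])) : Coeff →L[ℂ] Coeff :=
  LinearMap.mkContinuous
    { toFun := fun f => f.comp φ
      map_add' := fun _ _ => rfl
      map_smul' := fun _ _ => rfl } 1
    (fun f => by
      rw [one_mul]
      exact (ContinuousMap.norm_le _ (norm_nonneg _)).2 fun x => f.norm_coe_le_norm _)

@[simp] theorem pullbackCoeff_apply (φ : C(ℤ_[2], ℤ_[2])) (f : Coeff) (x : ℤ_[2]) :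
    pullbackCoeff φ f x = f (φ x) := rfl

/-- The map `x ↦ 2x`. -/
def doubling : C(ℤ_[2], ℤ_[2]) := ⟨fun x => 2 * x, by fun_prop⟩

/-- The restriction `x ↦ f (2x)` of a coefficient to the even dyadic integers. -/
def evenPart : Coeff →L[ℂ] Coeff := pullbackCoeff doubling

@[simp] theorem evenPart_apply (f : Coeff) (x : ℤ_[2]) : evenPart f x = f (2 * x) := rfl

/-- The reflection `x ↦ f (-1 - x)`. -/
def reflect : Coeff →L[ℂ] Coeff := pullbackCoeff ⟨fun x => -1 - x, by fun_prop⟩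

@[simp] theorem reflect_apply (f : Coeff) (x : ℤ_[2]) : reflect f x = f (-1 - x) := rfl

theorem reflect_reflect (f : Coeff) : reflect (reflect f) = f := by
  ext x; simp

theorem dyadic_even_or_odd (x : ℤ_[2]) : (∃ y, x = 2 * y) ∨ ∃ y, x = 2 * y + 1 := by
  have h := PadicInt.sub_zmodRepr_mem x
  rw [PadicInt.maximalIdeal_eq_span_p, Ideal.mem_span_singleton] at h
  obtain ⟨y, hy⟩ := h
  have h2 := PadicInt.zmodRepr_lt_p x
  push_cast at hy
  interval_cases hx : x.zmodRepr
  · left; exact ⟨y, by simpa using hy⟩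
  · right; exact ⟨y, by rw [← hy]; push_cast; ring⟩

theorem dyadic_two_mul_ne_two_mul_add_one (x y : ℤ_[2]) : 2 * x ≠ 2 * y + 1 := by
  intro h
  have h1 : (2 : ℤ_[2]) * (x - y) = 1 := by rw [mul_sub, h]; ring
  have h2 : IsUnit ((2 : ℕ) : ℤ_[2]) := by
    push_cast; exact IsUnit.of_mul_eq_one _ h1
  exact PadicInt.prime_p.not_isUnit h2

/-- The dyadic integers as the disjoint union of the even and the odd ones. -/
def dyadicSum : ℤ_[2] ⊕ ℤ_[2] ≃ₜ ℤ_[2] :=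
  Continuous.homeoOfEquivCompactToT2
    (f := Equiv.ofBijective (Sum.elim (fun x => 2 * x) (fun x => 2 * x + 1)) (by
      constructor
      · rintro (x | x) (y | y) h
        · simpa using h
        · exact absurd h (dyadic_two_mul_ne_two_mul_add_one _ _)
        · exact absurd h.symm (dyadic_two_mul_ne_two_mul_add_one _ _)
        · simpa using h
      · intro x
        rcases dyadic_even_or_odd x with ⟨y, rfl⟩ | ⟨y, rfl⟩
        · exact ⟨.inl y, rfl⟩
        · exact ⟨.inr y, rfl⟩))
    (by
      change Continuous (Sum.elim (fun x : ℤ_[2] => 2 * x) (fun x => 2 * x + 1))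
      exact Continuous.sumElim (by fun_prop) (by fun_prop))

theorem dyadicSum_symm_even (x : ℤ_[2]) : dyadicSum.symm (2 * x) = .inl x :=
  dyadicSum.symm_apply_apply (.inl x)

theorem dyadicSum_symm_odd (x : ℤ_[2]) : dyadicSum.symm (2 * x + 1) = .inr x :=
  dyadicSum.symm_apply_apply (.inr x)

/-- The coefficient with given restrictions to the even and to the odd dyadic integers. -/
def interleave : Coeff × Coeff →L[ℂ] Coeff :=
  LinearMap.mkContinuous
    { toFun := fun p => ⟨fun x => Sum.elim p.1 p.2 (dyadicSum.symm x),
        (Continuous.sumElim p.1.continuous p.2.continuous).comp dyadicSum.symm.continuous⟩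
      map_add' := fun p q => by
        ext x
        rcases dyadic_even_or_odd x with ⟨y, rfl⟩ | ⟨y, rfl⟩ <;>
          simp [dyadicSum_symm_even, dyadicSum_symm_odd]
      map_smul' := fun k p => by
        ext x
        rcases dyadic_even_or_odd x with ⟨y, rfl⟩ | ⟨y, rfl⟩ <;>
          simp [dyadicSum_symm_even, dyadicSum_symm_odd] } 1
    (fun p => by
      rw [one_mul]
      refine (ContinuousMap.norm_le _ (norm_nonneg _)).2 fun x => ?_
      rcases dyadic_even_or_odd x with ⟨y, rfl⟩ | ⟨y, rfl⟩
      · simpa [dyadicSum_symm_even] using (p.1.norm_coe_le_norm y).trans (norm_fst_le p)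
      · simpa [dyadicSum_symm_odd] using (p.2.norm_coe_le_norm y).trans (norm_snd_le p))

@[simp] theorem interleave_even (p : Coeff × Coeff) (x : ℤ_[2]) :
    interleave p (2 * x) = p.1 x := by
  change Sum.elim p.1 p.2 (dyadicSum.symm (2 * x)) = _
  rw [dyadicSum_symm_even]; rfl

@[simp] theorem interleave_odd (p : Coeff × Coeff) (x : ℤ_[2]) :
    interleave p (2 * x + 1) = p.2 x := by
  change Sum.elim p.1 p.2 (dyadicSum.symm (2 * x + 1)) = _
  rw [dyadicSum_symm_odd]; rfl

theorem coeff_ext_parity {f g : Coeff} (h0 : ∀ x, f (2 * x) = g (2 * x))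
    (h1 : ∀ x, f (2 * x + 1) = g (2 * x + 1)) : f = g := by
  ext x
  rcases dyadic_even_or_odd x with ⟨y, rfl⟩ | ⟨y, rfl⟩
  exacts [h0 y, h1 y]

/-! ### Jacobi operators in terms of their coefficients. -/

/-- The standard basis vectors of `ℓ²(ℤ)`. -/
def ellTwoSingle (m : ℤ) : EllTwo := lp.single 2 m (1 : ℂ)

theorem ellTwoSingle_apply (m n : ℤ) : ellTwoSingle m n = if n = m then 1 else 0 := by
  by_cases h : n = m
  · subst h; simp [ellTwoSingle]
  · simp [ellTwoSingle, h]

theorem norm_ellTwoSingle (m : ℤ) : ‖ellTwoSingle m‖ = 1 := by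
  simp [ellTwoSingle, lp.norm_single]

/-- The left side is the modulus of a single matrix entry of the difference. Together with
`norm_jacobi_sub_le` this identifies convergence in operator norm, uniform in the fibres, with
sup-norm convergence of the coefficients. -/
theorem norm_sub_apply_le_norm_jacobi_sub (a d : Coeff) (x : ℤ_[2]) :
    ‖a x - d x‖ ≤ ‖jacobi a x - jacobi d x‖ := by
  have h1 := (jacobi a x - jacobi d x).le_opNorm (ellTwoSingle 1)
  rw [norm_ellTwoSingle, mul_one] at h1
  refine le_trans (le_of_eq ?_) ((lp.norm_apply_le_norm two_ne_zero _ 0).trans h1)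
  rw [sub_apply, lp.coeFn_sub, Pi.sub_apply, jacobi_apply, jacobi_apply]
  simp [ellTwoSingle_apply]

theorem samplingMul_sub (a d : Coeff) (x : ℤ_[2]) :
    samplingMul a x - samplingMul d x = samplingMul (a - d) x := by
  ext u n
  exact (sub_mul _ _ _).symm

theorem norm_jacobi_sub_le (a d : Coeff) (x : ℤ_[2]) :
    ‖jacobi a x - jacobi d x‖ ≤ 2 * ‖a - d‖ := by
  have e : jacobi a x - jacobi d x = samplingMul (a - d) x ∘L translation 1
      + translation (-1) ∘L samplingMul (a - d) x := by
    rw [← samplingMul_sub, jacobi, jacobi, ContinuousLinearMap.sub_comp,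
      ContinuousLinearMap.comp_sub]
    abel
  have h1 : ‖samplingMul (a - d) x‖ ≤ ‖a - d‖ :=
    LinearMap.mkContinuous_norm_le _ (norm_nonneg _) _
  have h2 (m : ℤ) : ‖translation m‖ ≤ 1 :=
    ContinuousLinearMap.opNorm_le_bound _ zero_le_one fun u =>
      norm_le_of_norm_apply_le _ u (fun n => n + m) (add_left_injective m) 1 zero_le_one
        fun n => (one_mul ‖u (n + m)‖).ge
  rw [e, two_mul]
  refine (norm_add_le _ _).trans (add_le_add ?_ ?_)
  · refine (ContinuousLinearMap.opNorm_comp_le _ _).trans ?_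
    simpa using mul_le_mul h1 (h2 1) (norm_nonneg _) (norm_nonneg _)
  · refine (ContinuousLinearMap.opNorm_comp_le _ _).trans ?_
    simpa using mul_le_mul (h2 (-1)) h1 (norm_nonneg _) zero_le_one

/-- On even sites the square of a Jacobi matrix with zero diagonal is again tridiagonal. Applying
both sides to the basis vectors at `2` and `0` and reading off coordinate `0` gives the off-diagonal
and the diagonal equation. -/
theorem restrictEven_sq_eq_iff (c : ℂ) (a d : Coeff) :
    (∀ x : ℤ_[2], restrictEven ∘L
        (jacobi d (2 * x) ∘L jacobi d (2 * x) + c • ContinuousLinearMap.id ℂ EllTwo)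
      = jacobi a x ∘L restrictEven) ↔
    (∀ x, d (2 * x) * d (2 * x + 1) = a x) ∧
      ∀ x, d (2 * x) ^ 2 + d (2 * x - 1) ^ 2 = -c := by
  have key (x : ℤ_[2]) (u : EllTwo) (n : ℤ) :
      (restrictEven ∘L (jacobi d (2 * x) ∘L jacobi d (2 * x)
        + c • ContinuousLinearMap.id ℂ EllTwo)) u n =
      d (2 * (x + n)) * d (2 * (x + n) + 1) * u (2 * n + 2)
      + (d (2 * (x + n)) ^ 2 + d (2 * (x + n) - 1) ^ 2 + c) * u (2 * n)
      + d (2 * (x + n - 1) + 1) * d (2 * (x + n - 1)) * u (2 * n - 2) := by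
    change jacobi d (2 * x) (jacobi d (2 * x) u) (2 * n) + c * u (2 * n) = _
    rw [jacobi_apply, jacobi_apply, jacobi_apply]
    push_cast
    have e1 : (2 : ℤ) * n + 1 + 1 = 2 * n + 2 := by ring
    have e2 : (2 : ℤ) * n + 1 - 1 = 2 * n := by ring
    have e3 : (2 : ℤ) * n - 1 + 1 = 2 * n := by ring
    have e4 : (2 : ℤ) * n - 1 - 1 = 2 * n - 2 := by ring
    rw [e1, e2, e3, e4]
    have f1 : 2 * x + 2 * (n : ℤ_[2]) = 2 * (x + n) := by ring
    have f2 : 2 * x + (2 * (n : ℤ_[2]) + 1) = 2 * (x + n) + 1 := by ring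
    have f3 : 2 * (x + (n : ℤ_[2])) + 1 - 1 = 2 * (x + n) := by ring
    have f4 : 2 * x + (2 * (n : ℤ_[2]) - 1) = 2 * (x + n) - 1 := by ring
    have f5 : 2 * (x + (n : ℤ_[2])) - 1 - 1 = 2 * (x + n - 1) := by ring
    have f6 : 2 * (x + (n : ℤ_[2]) - 1) + 1 = 2 * (x + n) - 1 := by ring
    rw [f1, f2, f3, f4, f5, f6]
    ring
  have key2 (x : ℤ_[2]) (u : EllTwo) (n : ℤ) : (jacobi a x ∘L restrictEven) u n =
      a (x + n) * u (2 * n + 2) + a (x + n - 1) * u (2 * n - 2) := by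
    change jacobi a x (restrictEven u) n = _
    rw [jacobi_apply]
    change a (x + n) * u (2 * (n + 1)) + a (x + n - 1) * u (2 * (n - 1)) = _
    rw [mul_add, mul_sub, mul_one]
  constructor
  · intro h
    refine ⟨fun x => ?_, fun x => ?_⟩
    · have h1 := congrArg (fun A : EllTwo →L[ℂ] EllTwo => A (ellTwoSingle 2) 0) (h x)
      simp only [key, key2] at h1
      simpa [ellTwoSingle_apply] using h1
    · have h1 := congrArg (fun A : EllTwo →L[ℂ] EllTwo => A (ellTwoSingle 0) 0) (h x)
      simp only [key, key2] at h1
      exact eq_neg_of_add_eq_zero_left (by simpa [ellTwoSingle_apply] using h1)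
  · rintro ⟨h1, h2⟩ x
    ext u n
    rw [key, key2, h1, h2, mul_comm (d (2 * (x + n - 1) + 1)), h1]
    ring

/-! ### Attracting sections of the Riccati equation. -/

/-- The translation `f ↦ f (· + z)` of coefficients. -/
def shift (z : ℤ_[2]) : Coeff →L[ℂ] Coeff := pullbackCoeff ⟨fun x => x + z, by fun_prop⟩

@[simp] theorem shift_apply (z : ℤ_[2]) (f : Coeff) (x : ℤ_[2]) : shift z f x = f (x + z) := rfl

theorem exists_pos_le_norm_of_ne_zero {e : Coeff} (h : ∀ x, e x ≠ 0) :
    ∃ m : ℝ, 0 < m ∧ ∀ x, m ≤ ‖e x‖ := by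
  obtain ⟨x0, -, hx0⟩ := isCompact_univ.exists_isMinOn (Set.univ_nonempty (α := ℤ_[2]))
    (e.continuous.norm.continuousOn)
  exact ⟨‖e x0‖, norm_pos_iff.2 (h x0), fun x => hx0 (Set.mem_univ x)⟩

theorem ringInverse_apply {e : Coeff} (h : ∀ x, e x ≠ 0) (x : ℤ_[2]) :
    Ring.inverse e x = (e x)⁻¹ := by
  have h1 := Ring.mul_inverse_cancel e ((ContinuousMap.isUnit_iff_forall_ne_zero e).2 h)
  have h2 : e x * Ring.inverse e x = 1 := congrArg (fun f : Coeff => f x) h1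
  exact eq_inv_of_mul_eq_one_right h2

/-- Eventual contraction along the orbits of the adding machine is exponential. -/
theorem exists_exponential_bound {t : ℤ_[2] → ℝ} (h0 : ∀ x, 0 ≤ t x) {B : ℝ} (hB : ∀ x, t x ≤ B)
    {N : ℕ} (hN : ∀ x, ∏ k ∈ Finset.range N, t (x + k) ≤ 1 / 2) :
    ∃ K ρ : ℝ, 0 < ρ ∧ ρ < 1 ∧ 0 ≤ K ∧
      ∀ (x : ℤ_[2]) (n : ℕ), ∏ k ∈ Finset.range n, t (x + k) ≤ K * ρ ^ n := by
  have hN0 : N ≠ 0 := by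
    rintro rfl
    have := hN 0
    norm_num at this
  set C : ℝ := max B 1
  have hC : 1 ≤ C := le_max_right _ _
  set ρ : ℝ := (1 / 2) ^ (1 / (N : ℝ))
  have hρN : ρ ^ N = 1 / 2 := by
    rw [← Real.rpow_natCast, ← Real.rpow_mul (by norm_num)]
    simp [hN0]
  have hρ0 : 0 < ρ := by positivity
  have hρ1 : ρ < 1 := Real.rpow_lt_one (by norm_num) (by norm_num) (by positivity)
  -- Each full block of length `N` contributes `ρ ^ N = 1 / 2`. A remainder of length `n < N` costs
  -- at most `C ^ N`, and the factor `2` is needed because only `ρ ^ n ≥ 1 / 2` is available there.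
  refine ⟨2 * C ^ N, ρ, hρ0, hρ1, by positivity, fun x n => ?_⟩
  induction n using Nat.strong_induction_on generalizing x with
  | _ n ih =>
    rcases lt_or_ge n N with hn | hn
    · have h1 : ∏ k ∈ Finset.range n, t (x + k) ≤ C ^ n := by
        calc ∏ k ∈ Finset.range n, t (x + k) ≤ ∏ _k ∈ Finset.range n, C :=
              Finset.prod_le_prod (fun k _ => h0 _)
                fun k _ => (hB (x + k)).trans (le_max_left B 1)
          _ = C ^ n := by simp
      have h2 : C ^ n ≤ C ^ N := pow_le_pow_right₀ hC hn.le
      have h3 : 1 / 2 ≤ ρ ^ n := by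
        rw [← hρN]; exact pow_le_pow_of_le_one hρ0.le hρ1.le hn.le
      have h4 : 0 ≤ C ^ N := by positivity
      nlinarith
    · obtain ⟨m, rfl⟩ := Nat.exists_eq_add_of_le hn
      rw [Finset.prod_range_add, pow_add, hρN]
      have h1 := ih m (by omega) (x + N)
      have h2 : ∏ k ∈ Finset.range m, t (x + (N + k : ℕ))
          = ∏ k ∈ Finset.range m, t (x + N + k) :=
        Finset.prod_congr rfl fun k _ => by push_cast; rw [add_assoc]
      rw [h2]
      refine (mul_le_mul (hN x) h1 (Finset.prod_nonneg fun k _ => h0 _) (by norm_num)).trans ?_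
      exact le_of_eq (by ring)

/-- `e ^ 2` is the section `y ↦ -v(y + 1) / v(y)` of ratios of the solutions of `L v = c v` that
decay at `-∞`, for the Jacobi operator whose squared coefficient is `b`. -/
structure IsUnstableSection (c : ℂ) (b e : Coeff) : Prop where
  ne_zero : ∀ x, e x ≠ 0
  riccati : ∀ x, e (x + 1) ^ 2 + b x / e x ^ 2 = -c
  contracting : ∃ N : ℕ, ∀ x, ∏ k ∈ Finset.range N, (‖b (x + k)‖ / ‖e (x + k)‖ ^ 4) ≤ 1 / 2

theorem IsUnstableSection.exponential {c : ℂ} {b e : Coeff} (h : IsUnstableSection c b e) :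
    ∃ K ρ : ℝ, 0 < ρ ∧ ρ < 1 ∧ 0 ≤ K ∧ ∀ (x : ℤ_[2]) (n : ℕ),
      ∏ k ∈ Finset.range n, (‖b (x + k)‖ / ‖e (x + k)‖ ^ 4) ≤ K * ρ ^ n := by
  obtain ⟨N, hN⟩ := h.contracting
  obtain ⟨m, hm, hme⟩ := exists_pos_le_norm_of_ne_zero h.ne_zero
  refine exists_exponential_bound (t := fun x => ‖b x‖ / ‖e x‖ ^ 4) (fun x => by positivity)
    (B := ‖b‖ / m ^ 4) (fun x => ?_) hN
  have h1 := hme x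
  have h2 := b.norm_coe_le_norm x
  gcongr

theorem exists_mul_pow_le {K ρ : ℝ} (h0 : 0 < ρ) (h1 : ρ < 1) {ε : ℝ} (hε : 0 < ε) :
    ∃ n : ℕ, K * ρ ^ n ≤ ε := by
  have h := (tendsto_pow_atTop_nhds_zero_of_lt_one h0.le h1).const_mul K
  rw [mul_zero] at h
  exact (h.eventually_le_const hε).exists

/-- Subtracting the two Riccati equations multiplies the difference of the sections by `b / (e^2
e'^2)` at each step. The squared modulus of this factor is the product of the two contraction
factors, so a bounded difference, followed forward from the far past, vanishes. -/
theorem IsUnstableSection.sq_unique {c : ℂ} {b e e' : Coeff} (h : IsUnstableSection c b e)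
    (h' : IsUnstableSection c b e') : e ^ 2 = e' ^ 2 := by
  obtain ⟨K, ρ, hρ0, hρ1, hK, hb⟩ := h.exponential
  obtain ⟨K', ρ', hρ0', hρ1', hK', hb'⟩ := h'.exponential
  have step (x : ℤ_[2]) (n : ℕ) : ‖(e ^ 2 - e' ^ 2) (x + n)‖ ^ 2 =
      (∏ k ∈ Finset.range n, (‖b (x + k)‖ / ‖e (x + k)‖ ^ 4)) *
      (∏ k ∈ Finset.range n, (‖b (x + k)‖ / ‖e' (x + k)‖ ^ 4)) * ‖(e ^ 2 - e' ^ 2) x‖ ^ 2 := by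
    induction n with
    | zero => simp
    | succ n ih =>
      rw [Finset.prod_range_succ, Finset.prod_range_succ]
      have e1 : (e ^ 2 - e' ^ 2) (x + (n + 1 : ℕ)) =
          b (x + n) * (e ^ 2 - e' ^ 2) (x + n) / (e (x + n) ^ 2 * e' (x + n) ^ 2) := by
        have r1 := h.riccati (x + n)
        have r2 := h'.riccati (x + n)
        have z1 := h.ne_zero (x + n)
        have z2 := h'.ne_zero (x + n)
        have r3 : e (x + n + 1) ^ 2 = -c - b (x + n) / e (x + n) ^ 2 := by rw [← r1]; ring
        have r4 : e' (x + n + 1) ^ 2 = -c - b (x + n) / e' (x + n) ^ 2 := by rw [← r2]; ring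
        simp only [ContinuousMap.sub_apply, ContinuousMap.pow_apply]
        push_cast
        rw [← add_assoc, r3, r4]
        field_simp
        ring
      rw [e1, norm_div, norm_mul, div_pow, mul_pow, ih, norm_mul, norm_pow, norm_pow]
      have z1 := norm_ne_zero_iff.2 (h.ne_zero (x + n))
      have z2 := norm_ne_zero_iff.2 (h'.ne_zero (x + n))
      field_simp
  ext y
  have lim : Tendsto (fun n : ℕ => K * K' * (ρ * ρ') ^ n * ‖e ^ 2 - e' ^ 2‖ ^ 2) atTop (𝓝 0) := by
    have h1 : ρ * ρ' < 1 := by nlinarith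
    simpa using ((tendsto_pow_atTop_nhds_zero_of_lt_one (by positivity) h1).const_mul
      (K * K')).mul_const (‖e ^ 2 - e' ^ 2‖ ^ 2)
  have h2 : ‖(e ^ 2 - e' ^ 2) y‖ ^ 2 ≤ 0 := by
    refine ge_of_tendsto' lim fun n => ?_
    have h3 := step (y - n) n
    rw [sub_add_cancel] at h3
    rw [h3, mul_pow]
    have h4 : ‖(e ^ 2 - e' ^ 2) (y - n)‖ ≤ ‖e ^ 2 - e' ^ 2‖ := ContinuousMap.norm_coe_le_norm _ _
    have h5 := mul_le_mul (hb (y - n) n) (hb' (y - n) n)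
      (Finset.prod_nonneg fun _ _ => by positivity) (by positivity)
    calc _ ≤ (K * ρ ^ n * (K' * ρ' ^ n)) * ‖e ^ 2 - e' ^ 2‖ ^ 2 := by gcongr
      _ = _ := by ring
  have h6 : (e ^ 2 - e' ^ 2) y = 0 := by
    rw [← norm_eq_zero]; nlinarith [norm_nonneg ((e ^ 2 - e' ^ 2) y)]
  exact sub_eq_zero.1 h6

theorem IsUnstableSection.scale {c : ℂ} {b e : Coeff} (h : IsUnstableSection c b e) {s : ℂ}
    (hs : s ≠ 0) : IsUnstableSection (s ^ 2 * c) (s ^ 4 • b) (s • e) where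
  ne_zero x := mul_ne_zero hs (h.ne_zero x)
  riccati x := by
    have h1 := h.riccati x
    have h2 := h.ne_zero x
    simp only [ContinuousMap.smul_apply, smul_eq_mul]
    have h3 : s ^ 4 * b x / (s * e x) ^ 2 = s ^ 2 * (b x / e x ^ 2) := by field_simp
    rw [h3, mul_pow, ← mul_add, h1]; ring
  contracting := by
    obtain ⟨N, hN⟩ := h.contracting
    refine ⟨N, fun x => le_trans (le_of_eq (Finset.prod_congr rfl fun k _ => ?_)) (hN x)⟩
    have h1 := norm_ne_zero_iff.2 hs
    have h2 := norm_ne_zero_iff.2 (h.ne_zero (x + k))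
    simp only [ContinuousMap.smul_apply, smul_eq_mul, norm_mul, norm_pow]
    field_simp

theorem isUnit_one_sub_of_norm_pow_lt_one {R : Type*} [NormedRing R] [CompleteSpace R] {t : R}
    {N : ℕ} (h : ‖t ^ N‖ < 1) : IsUnit (1 - t) := by
  have h1 : IsUnit (1 - t ^ N) := isUnit_one_sub_of_norm_lt_one h
  rw [← mul_neg_geom_sum] at h1
  refine ((Commute.isUnit_mul_iff ?_).1 h1).1
  exact (Commute.one_left _).sub_left (Commute.sum_right _ _ _ fun i _ => Commute.self_pow t i)

/-- The Riccati equation `e(x + 1) ^ 2 + b(x) / e(x) ^ 2 + c = 0`. -/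
def riccatiMap (v : (ℂ × Coeff) × Coeff) : Coeff :=
  shift 1 v.2 ^ 2 + v.1.2 * Ring.inverse v.2 ^ 2 + v.1.1 • 1

theorem contDiffAt_inverse_coeff {e : Coeff} (h : ∀ x, e x ≠ 0) :
    ContDiffAt ℂ 1 (Ring.inverse : Coeff → Coeff) e := by
  obtain ⟨u, rfl⟩ := (ContinuousMap.isUnit_iff_forall_ne_zero e).2 h
  exact contDiffAt_ringInverse ℂ u

theorem contDiffAt_riccatiMap {v : (ℂ × Coeff) × Coeff} (h : ∀ x, v.2 x ≠ 0) :
    ContDiffAt ℂ 1 riccatiMap v := by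
  unfold riccatiMap
  have h1 : ContDiffAt ℂ 1 (fun v : (ℂ × Coeff) × Coeff => Ring.inverse v.2) v :=
    (contDiffAt_inverse_coeff h).comp v contDiffAt_snd
  have h2 : ContDiffAt ℂ 1 (fun v : (ℂ × Coeff) × Coeff => shift 1 v.2) v :=
    (shift 1).contDiff.contDiffAt.comp v contDiffAt_snd
  have h3 : ContDiffAt ℂ 1 (fun v : (ℂ × Coeff) × Coeff => v.1.2) v :=
    contDiffAt_snd.comp v contDiffAt_fst
  have h4 : ContDiffAt ℂ 1 (fun v : (ℂ × Coeff) × Coeff => v.1.1) v :=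
    contDiffAt_fst.comp v contDiffAt_fst
  exact ((h2.pow 2).add (h3.mul (h1.pow 2))).add (h4.smul contDiffAt_const)

/-- Factor out the shift: what remains is `1 - t` with `t` a weighted backward shift. The weights of
`t ^ N` are products of `g` along orbit segments of length `N`, so `‖t ^ N‖ ≤ 1 / 2`. -/
theorem isUnit_shift_sub_mul {g : Coeff}
    {N : ℕ} (hN : ∀ x, ∏ k ∈ Finset.range N, ‖g (x + k)‖ ≤ 1 / 2) :
    IsUnit (shift 1 - ContinuousLinearMap.mul ℂ Coeff g) := by
  have hS : IsUnit (shift 1) := ⟨⟨shift 1, shift (-1), by ext f x; simp, by ext f x; simp⟩, rfl⟩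
  set t : Coeff →L[ℂ] Coeff := ContinuousLinearMap.mul ℂ Coeff g * shift (-1)
  have e1 : shift 1 - ContinuousLinearMap.mul ℂ Coeff g = (1 - t) * shift 1 := by
    ext f x; simp [t]
  have tpow (n : ℕ) (f : Coeff) (x : ℤ_[2]) :
      (t ^ n) f x = (∏ k ∈ Finset.range n, g (x - k)) * f (x - n) := by
    induction n generalizing f with
    | zero => simp
    | succ n ih =>
      rw [pow_succ, mul_apply_eq_comp, ih, Finset.prod_range_succ]
      simp [t, mul_assoc, sub_eq_add_neg, add_assoc, add_comm]
  rw [e1]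
  refine (isUnit_one_sub_of_norm_pow_lt_one (R := Coeff →L[ℂ] Coeff) (N := N)
    (lt_of_le_of_lt ?_ one_half_lt_one)).mul hS
  refine ContinuousLinearMap.opNorm_le_bound _ (by norm_num) fun f => ?_
  refine (ContinuousMap.norm_le _ (by positivity)).2 fun x => ?_
  rw [tpow, norm_mul, norm_prod]
  refine mul_le_mul ?_ (f.norm_coe_le_norm _) (norm_nonneg _) (by norm_num)
  refine le_trans (le_of_eq ?_) (hN (x - N + 1))
  rw [← Finset.prod_range_reflect]
  refine Finset.prod_congr rfl fun k hk => ?_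
  have hk' : k + 1 ≤ N := Finset.mem_range.1 hk
  rw [Nat.sub_sub, Nat.cast_sub (by omega)]
  congr 2
  push_cast
  ring

/-- The partial derivative in `e` is `f ↦ (shift 1 - g)(2 e f)` with `g = b / e^4`. The second
factor is invertible since `e` has no zero, the first because `g` is the contraction factor of the
section. -/
theorem isInvertible_riccatiMap {c : ℂ} {b e : Coeff} (h : IsUnstableSection c b e) :
    (fderiv ℂ riccatiMap ((c, b), e) ∘L .inr ℂ (ℂ × Coeff) Coeff).IsInvertible := by
  obtain ⟨N, hN⟩ := h.contracting
  have hu := (ContinuousMap.isUnit_iff_forall_ne_zero e).2 h.ne_zero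
  set i := Ring.inverse e
  have hi (x : ℤ_[2]) : i x = (e x)⁻¹ := ringInverse_apply h.ne_zero x
  have h1 : HasFDerivAt riccatiMap (fderiv ℂ riccatiMap ((c, b), e)) ((c, b), e) :=
    ((contDiffAt_riccatiMap (v := ((c, b), e)) h.ne_zero).differentiableAt one_ne_zero).hasFDerivAt
  have h2 : HasFDerivAt (fun f : Coeff => riccatiMap ((c, b), f))
      (fderiv ℂ riccatiMap ((c, b), e) ∘L .inr ℂ (ℂ × Coeff) Coeff) e :=
    h1.comp e (hasFDerivAt_prodMk_right (c, b) e)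
  have hinv : HasFDerivAt (Ring.inverse : Coeff → Coeff)
      (-ContinuousLinearMap.mulLeftRight ℂ Coeff i i) e := by
    have := hasFDerivAt_ringInverse (𝕜 := ℂ) hu.unit
    have hi' : (↑hu.unit⁻¹ : Coeff) = i := (Ring.inverse_unit hu.unit).symm
    rw [hi'] at this
    exact this
  have h3 := ((((shift 1).hasFDerivAt (x := e)).pow 2).add
    (((hinv.pow 2).const_mul b))).add_const (c • (1 : Coeff))
  have h4 := h2.unique h3
  set g : Coeff := b * i ^ 4
  have hg : IsUnit (shift 1 - ContinuousLinearMap.mul ℂ Coeff g) := by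
    refine isUnit_shift_sub_mul (N := N) fun x => ?_
    refine le_trans (le_of_eq (Finset.prod_congr rfl fun k _ => ?_)) (hN x)
    simp [g, hi, div_eq_mul_inv]
  have hm : IsUnit (ContinuousLinearMap.mul ℂ Coeff ((2 : ℂ) • e)) := by
    refine ⟨⟨_, ContinuousLinearMap.mul ℂ Coeff ((2⁻¹ : ℂ) • i), ?_, ?_⟩, rfl⟩ <;>
    · ext f x
      have := h.ne_zero x
      simp [hi]
      field_simp
  obtain ⟨u, hu'⟩ := hg.mul hm
  refine ⟨ContinuousLinearEquiv.unitsEquiv ℂ Coeff u, ?_⟩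
  rw [h4]
  ext f x
  have hx := h.ne_zero x
  have e1 : (ContinuousLinearEquiv.unitsEquiv ℂ Coeff u : Coeff →L[ℂ] Coeff) f
      = ((shift 1 - ContinuousLinearMap.mul ℂ Coeff g) *
        ContinuousLinearMap.mul ℂ Coeff ((2 : ℂ) • e)) f := by rw [← hu']; rfl
  rw [e1]
  have e2 : (2 : Coeff) x = 2 := rfl
  simp [g, hi, ringInverse_apply h.ne_zero, e2]
  field_simp
  ring

/-- The unstable section depends smoothly on the energy and on the coefficient. -/
theorem IsUnstableSection.exists_local {c₀ : ℂ} {b₀ e₀ : Coeff}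
    (h : IsUnstableSection c₀ b₀ e₀) :
    ∃ E : ℂ × Coeff → Coeff, E (c₀, b₀) = e₀ ∧ ContDiffAt ℂ 1 E (c₀, b₀) ∧
      ∀ᶠ v in 𝓝 (c₀, b₀), IsUnstableSection v.1 v.2 (E v) := by
  have hG := contDiffAt_riccatiMap (v := ((c₀, b₀), e₀)) h.ne_zero
  have hI := isInvertible_riccatiMap h
  set E := hG.implicitFunction one_ne_zero hI
  have hE0 : E (c₀, b₀) = e₀ := hG.implicitFunction_apply_self one_ne_zero hI
  have hE : ContDiffAt ℂ 1 E (c₀, b₀) := hG.contDiffAt_implicitFunction one_ne_zero hI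
  have hG0 : riccatiMap ((c₀, b₀), e₀) = 0 := by
    ext x
    have := h.riccati x
    simp [riccatiMap, ringInverse_apply h.ne_zero]
    rw [← neg_eq_iff_eq_neg] at this
    rw [← this]; field_simp; ring
  have hev : ∀ᶠ v in 𝓝 (c₀, b₀), riccatiMap (v, E v) = 0 := by
    have := hG.eventually_apply_implicitFunction one_ne_zero hI
    rwa [hG0] at this
  have hEc : Tendsto E (𝓝 (c₀, b₀)) (𝓝 e₀) := by
    have := hE.continuousAt.tendsto
    rwa [hE0] at this
  have hunit : ∀ᶠ v in 𝓝 (c₀, b₀), IsUnit (E v) :=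
    hEc.eventually (Units.isOpen.mem_nhds
      ((ContinuousMap.isUnit_iff_forall_ne_zero e₀).2 h.ne_zero))
  obtain ⟨K, ρ, hρ0, hρ1, -, hb⟩ := h.exponential
  -- A longer block reaches `1 / 4`, leaving room for the bound `1 / 2` to survive a perturbation;
  -- the given block may attain `1 / 2`.
  obtain ⟨N, hN⟩ := exists_mul_pow_le (K := K) hρ0 hρ1 (ε := 1 / 4) (by norm_num)
  have hcont : Tendsto (fun v : ℂ × Coeff => ∏ k ∈ Finset.range N,
      shift (k : ℤ_[2]) (v.2 * Ring.inverse (E v) ^ 4)) (𝓝 (c₀, b₀))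
      (𝓝 (∏ k ∈ Finset.range N, shift (k : ℤ_[2]) (b₀ * Ring.inverse e₀ ^ 4))) := by
    refine tendsto_finsetProd _ fun k _ => ((shift _).continuous.tendsto _).comp ?_
    exact (continuous_snd.tendsto (c₀, b₀)).mul
      ((((contDiffAt_inverse_coeff h.ne_zero).continuousAt.tendsto).comp hEc).pow 4)
  have hlt : ‖∏ k ∈ Finset.range N, shift (k : ℤ_[2]) (b₀ * Ring.inverse e₀ ^ 4)‖ < 1 / 2 := by
    refine lt_of_le_of_lt ((ContinuousMap.norm_le _ (by norm_num)).2 fun x => ?_)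
      (show (1 / 4 : ℝ) < 1 / 2 by norm_num)
    rw [ContinuousMap.prod_apply, norm_prod]
    refine le_trans (le_of_eq (Finset.prod_congr rfl fun k _ => ?_)) ((hb x N).trans hN)
    simp [ringInverse_apply h.ne_zero, div_eq_mul_inv]
  refine ⟨E, hE0, hE, ?_⟩
  filter_upwards [hev, hunit, hcont.norm.eventually_lt_const hlt] with v h1 h2 h3
  have hz := (ContinuousMap.isUnit_iff_forall_ne_zero (E v)).1 h2
  refine ⟨hz, fun x => ?_, N, fun x => ?_⟩
  · have h4 : riccatiMap (v, E v) x = 0 := by rw [h1]; rfl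
    simp [riccatiMap, ringInverse_apply hz] at h4
    rw [← neg_eq_iff_eq_neg, neg_eq_iff_add_eq_zero, ← h4]
    field_simp
  · refine le_trans (le_of_eq ?_) ((ContinuousMap.norm_coe_le_norm _ x).trans h3.le)
    rw [ContinuousMap.prod_apply, norm_prod]
    refine Finset.prod_congr rfl fun k _ => ?_
    simp [ringInverse_apply hz, div_eq_mul_inv]

/-! ### Reduction of both branches to unstable sections. -/

/-- Reflection of the coefficient on the stable branch, identity on the unstable one. -/
def orient : WeylBranch → Coeff →L[ℂ] Coeff
  | .unstable => ContinuousLinearMap.id ℂ Coeff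
  | .stable => reflect

theorem orient_orient (s : WeylBranch) (f : Coeff) : orient s (orient s f) = f := by
  cases s
  · rfl
  · exact reflect_reflect f

theorem norm_orient_le (s : WeylBranch) (f : Coeff) : ‖orient s f‖ ≤ ‖f‖ := by
  cases s
  · exact le_rfl
  · exact (ContinuousMap.norm_le _ (norm_nonneg _)).2 fun x => f.norm_coe_le_norm _

/-- One step of the renormalization map on the unstable branch, in terms of the coefficients. -/
def IsUnstableStep (c : ℂ) (a d : Coeff) : Prop :=
  IsUnstableSection c (a ^ 2) (evenPart d) ∧ ∀ x, d (2 * x) * d (2 * x + 1) = a x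

theorem isRenormalization_unstable_iff (c : ℂ) (a d : Coeff) :
    IsRenormalization .unstable c a d ↔ IsUnstableStep c a d := by
  rw [IsRenormalization, restrictEven_sq_eq_iff]
  have ratio (hd : ∀ x, d (2 * x) ≠ 0) (ha : ∀ x, d (2 * x) * d (2 * x + 1) = a x)
      (x : ℤ_[2]) : ‖(a ^ 2) x‖ / ‖evenPart d x‖ ^ 4
        = (‖d (2 * x + 1)‖ / ‖d (2 * x)‖) ^ 2 := by
    have h1 := norm_ne_zero_iff.2 (hd x)
    rw [ContinuousMap.pow_apply, ← ha x, evenPart_apply, norm_pow, norm_mul]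
    field_simp
  constructor
  · rintro ⟨⟨hd, K, ρ, hρ0, hρ1, hK⟩, ha, hc⟩
    refine ⟨⟨hd, fun x => ?_, ?_⟩, ha⟩
    · have h1 := hc (x + 1)
      have h2 : 2 * (x + 1) - 1 = 2 * x + 1 := by ring
      rw [h2] at h1
      have h3 := hd x
      rw [ContinuousMap.pow_apply, ← ha x, evenPart_apply, evenPart_apply, ← h1]
      field_simp
    · obtain ⟨N, hN⟩ := exists_mul_pow_le (K := K) hρ0 hρ1 (ε := 1 / 2) (by norm_num)
      refine ⟨N, fun x => ?_⟩
      have h1 : ∏ k ∈ Finset.range N, (‖d (2 * (x + k) + 1)‖ / ‖d (2 * (x + k))‖) ≤ 1 / 2 := by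
        rw [Finset.prod_div_distrib]
        refine le_trans ?_ hN
        rw [div_le_iff₀ (Finset.prod_pos fun k _ => norm_pos_iff.2 (hd _))]
        exact hK x N
      rw [Finset.prod_congr rfl fun (k : ℕ) _ => ratio hd ha (x + k), Finset.prod_pow]
      have h2 : 0 ≤ ∏ k ∈ Finset.range N, (‖d (2 * (x + k) + 1)‖ / ‖d (2 * (x + k))‖) :=
        Finset.prod_nonneg fun k _ => by positivity
      nlinarith
  · rintro ⟨h, ha⟩
    have hd : ∀ x, d (2 * x) ≠ 0 := h.ne_zero
    refine ⟨⟨hd, ?_⟩, ha, fun x => ?_⟩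
    · obtain ⟨K, ρ, hρ0, hρ1, hK, hb⟩ := h.exponential
      refine ⟨√K, √ρ, by positivity, by rwa [Real.sqrt_lt' one_pos, one_pow], fun x N => ?_⟩
      rw [← div_le_iff₀ (Finset.prod_pos fun k _ => norm_pos_iff.2 (hd _)),
        ← Finset.prod_div_distrib]
      refine le_of_sq_le_sq ?_ (by positivity)
      rw [mul_pow, ← pow_mul, mul_comm N 2, pow_mul, Real.sq_sqrt hK, Real.sq_sqrt hρ0.le,
        ← Finset.prod_pow]
      rw [← Finset.prod_congr rfl fun (k : ℕ) _ => ratio hd ha (x + k)]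
      exact hb x N
    · have h1 := h.riccati (x - 1)
      have h2 := hd (x - 1)
      rw [ContinuousMap.pow_apply, ← ha (x - 1), evenPart_apply, evenPart_apply, sub_add_cancel,
        mul_pow, mul_div_cancel_left₀ _ (pow_ne_zero 2 h2)] at h1
      rw [← h1]
      congr 3
      ring

theorem isRenormalization_stable_iff (c : ℂ) (a d : Coeff) :
    IsRenormalization .stable c a d ↔ IsRenormalization .unstable c (reflect a) (reflect d) := by
  rw [IsRenormalization, IsRenormalization, restrictEven_sq_eq_iff, restrictEven_sq_eq_iff]
  have e1 (x : ℤ_[2]) : -1 - 2 * x = 2 * (-1 - x) + 1 := by ring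
  have e2 (x : ℤ_[2]) : -1 - (2 * x + 1) = 2 * (-1 - x) := by ring
  have e3 (x : ℤ_[2]) : -1 - (2 * x - 1) = 2 * -x := by ring
  have e4 (x : ℤ_[2]) : 2 * (-1 - x) + 1 = 2 * -x - 1 := by ring
  have surj {p : ℤ_[2] → Prop} : (∀ x, p (-1 - x)) ↔ ∀ x, p x :=
    ⟨fun h x => by simpa using h (-1 - x), fun h x => h _⟩
  have surj' {p : ℤ_[2] → Prop} : (∀ x, p (-x)) ↔ ∀ x, p x :=
    ⟨fun h x => by simpa using h (-x), fun h x => h _⟩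
  refine and_congr ?_ (and_congr ?_ ?_)
  · simp only [IsWeylBranch, reflect_apply, e1, e2]
    refine and_congr (surj (p := fun x => d (2 * x + 1) ≠ 0)).symm ?_
    refine exists_congr fun K => exists_congr fun ρ => and_congr_right fun _ =>
      and_congr_right fun _ => ?_
    -- Reflection reverses the orbit. Since the bounds are uniform in the base point, a backward
    -- segment may be read as a forward one from its other end.
    have flip (f : ℤ_[2] → ℝ) (x : ℤ_[2]) (N : ℕ) :
        ∏ k ∈ Finset.range N, f (-1 - (x + k)) = ∏ k ∈ Finset.range N, f (-x - N + k) := by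
      rw [← Finset.prod_range_reflect]
      refine Finset.prod_congr rfl fun k hk => ?_
      have hk' : k + 1 ≤ N := Finset.mem_range.1 hk
      rw [Nat.sub_sub, Nat.cast_sub (by omega)]
      congr 1
      push_cast
      ring
    have f1 := flip fun x => ‖d (2 * x)‖
    have f2 := flip fun x => ‖d (2 * x + 1)‖
    simp only [f1, f2]
    constructor
    · exact fun h x N => h _ N
    · intro h x N
      have := h (-x - N) N
      simpa using this
  · simp only [reflect_apply, e1, e2]
    rw [← surj]
    exact forall_congr' fun x => by rw [mul_comm]
  · simp only [reflect_apply, e1, e3, e4]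
    rw [← surj']
    exact forall_congr' fun x => by rw [add_comm]

theorem isRenormalization_iff (s : WeylBranch) (c : ℂ) (a d : Coeff) :
    IsRenormalization s c a d ↔ IsUnstableStep c (orient s a) (orient s d) := by
  cases s
  · exact isRenormalization_unstable_iff c a d
  · rw [isRenormalization_stable_iff]
    exact isRenormalization_unstable_iff c _ _

/-- Convergence of the iterates of the renormalization map, in terms of the coefficients. -/
def CoeffConverges (c : ℂ) : Prop :=
  ∃ d : Coeff, ∃ U ∈ 𝓝 d, ∃ Φ : ℕ → Coeff → Coeff,
    (∀ a ∈ U, Φ 0 a = a ∧ ∀ n, IsUnstableStep c (Φ n a) (Φ (n + 1) a)) ∧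
    TendstoUniformlyOn Φ (fun _ => d) atTop U

theorem tendstoUniformlyOn_jacobi_iff {d : Coeff} {U : Set Coeff} {Φ : ℕ → Coeff → Coeff} :
    TendstoUniformlyOn (fun (n : ℕ) (p : Coeff × ℤ_[2]) => jacobi (Φ n p.1) p.2)
      (fun p => jacobi d p.2) atTop (U ×ˢ Set.univ) ↔
    TendstoUniformlyOn Φ (fun _ => d) atTop U := by
  rw [Metric.tendstoUniformlyOn_iff, Metric.tendstoUniformlyOn_iff]
  constructor
  · intro h ε hε
    filter_upwards [h (ε / 2) (by positivity)] with n hn a ha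
    rw [dist_eq_norm]
    refine lt_of_le_of_lt ((ContinuousMap.norm_le _ (by positivity)).2 fun x => ?_)
      (half_lt_self hε)
    have := hn (a, x) ⟨ha, trivial⟩
    rw [dist_eq_norm] at this
    exact (norm_sub_apply_le_norm_jacobi_sub d _ x).trans this.le
  · intro h ε hε
    filter_upwards [h (ε / 2) (by positivity)] with n hn p hp
    have := hn p.1 hp.1
    rw [dist_eq_norm] at this ⊢
    refine (norm_jacobi_sub_le _ _ _).trans_lt ?_
    linarith

theorem renormalizationConverges_iff (s : WeylBranch) (c : ℂ) :
    RenormalizationConverges s c ↔ CoeffConverges c := by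
  have unif {d : Coeff} {U : Set Coeff} {Φ : ℕ → Coeff → Coeff}
      (h : TendstoUniformlyOn Φ (fun _ => d) atTop U) :
      TendstoUniformlyOn (fun n a => orient s (Φ n (orient s a))) (fun _ => orient s d) atTop
        (orient s ⁻¹' U) := by
    rw [Metric.tendstoUniformlyOn_iff] at h ⊢
    intro ε hε
    filter_upwards [h ε hε] with n hn a ha
    have := hn _ ha
    rw [dist_eq_norm] at this ⊢
    rw [← map_sub]
    exact (norm_orient_le s _).trans_lt this
  have nhd {d : Coeff} {U : Set Coeff} (hU : U ∈ 𝓝 d) : orient s ⁻¹' U ∈ 𝓝 (orient s d) := by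
    refine (orient s).continuous.continuousAt.preimage_mem_nhds ?_
    rwa [orient_orient]
  simp only [RenormalizationConverges, tendstoUniformlyOn_jacobi_iff, isRenormalization_iff]
  constructor
  · rintro ⟨d, U, hU, Φ, hΦ, hlim⟩
    refine ⟨orient s d, _, nhd hU, _, fun a ha => ⟨?_, fun n => ?_⟩, unif hlim⟩
    · rw [(hΦ _ ha).1, orient_orient]
    · exact (hΦ _ ha).2 n
  · rintro ⟨d, U, hU, Φ, hΦ, hlim⟩
    refine ⟨orient s d, _, nhd hU, _, fun a ha => ⟨?_, fun n => ?_⟩, unif hlim⟩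
    · rw [(hΦ _ ha).1, orient_orient]
    · rw [orient_orient, orient_orient]
      exact (hΦ _ ha).2 n

/-! ### Persistence of attracting fixed points. -/

theorem exists_one_lt_pow_mul_le {r : ℝ} (hr : r < 1) (N : ℕ) :
    ∃ θ : ℝ, 1 < θ ∧ θ ^ N * r ≤ 1 := by
  have h : Tendsto (fun θ : ℝ => θ ^ N * r) (𝓝[>] 1) (𝓝 (1 ^ N * r)) :=
    (((continuous_pow N).mul continuous_const).tendsto 1).mono_left nhdsWithin_le_nhds
  rw [one_pow, one_mul] at h
  obtain ⟨θ, h1, h2⟩ := ((h.eventually_le_const hr).and self_mem_nhdsWithin).exists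
  exact ⟨θ, h2, h1⟩

/-- An operator with a power of norm less than one is a strict contraction for an equivalent
norm. -/
theorem exists_adapted_norm {X : Type*} [NormedAddCommGroup X] [NormedSpace ℂ X]
    (A : X →L[ℂ] X) {N : ℕ} (hN : ‖A ^ (N + 1)‖ < 1) :
    ∃ (g : X → ℝ) (C θ : ℝ), 0 < C ∧ 0 ≤ θ ∧ θ < 1 ∧ (∀ x, ‖x‖ ≤ g x) ∧ (∀ x, g x ≤ C * ‖x‖) ∧
      (∀ x y, g (x + y) ≤ g x + g y) ∧ (∀ x, g (A x) ≤ θ * g x) ∧ Continuous g := by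
  obtain ⟨θ, hθ1, hθ⟩ := exists_one_lt_pow_mul_le hN (N + 1)
  have hθ0 : 0 < θ := by linarith
  -- The norm is a weighted sum over the orbit of `A`. Applying `A` shifts the sum and gains `θ⁻¹`;
  -- the new last term is at most `‖x‖`, the lost first one, by the choice of `θ`.
  refine ⟨fun x => ∑ j ∈ Finset.range (N + 1), θ ^ j * ‖(A ^ j) x‖,
    1 + ∑ j ∈ Finset.range (N + 1), θ ^ j * ‖A ^ j‖, θ⁻¹, by positivity, by positivity,
    inv_lt_one_of_one_lt₀ hθ1, fun x => ?_, fun x => ?_, fun x y => ?_, fun x => ?_, ?_⟩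
  · beta_reduce
    rw [Finset.sum_range_succ']
    have : 0 ≤ ∑ k ∈ Finset.range N, θ ^ (k + 1) * ‖(A ^ (k + 1)) x‖ := by positivity
    simpa using this
  · have : ∑ j ∈ Finset.range (N + 1), θ ^ j * ‖(A ^ j) x‖
        ≤ (∑ j ∈ Finset.range (N + 1), θ ^ j * ‖A ^ j‖) * ‖x‖ := by
      rw [Finset.sum_mul]
      refine Finset.sum_le_sum fun j _ => ?_
      rw [mul_assoc]
      gcongr
      exact (A ^ j).le_opNorm x
    nlinarith [norm_nonneg x]
  · rw [← Finset.sum_add_distrib]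
    refine Finset.sum_le_sum fun j _ => ?_
    rw [← mul_add, map_add]
    gcongr
    exact norm_add_le _ _
  · rw [← div_eq_inv_mul, le_div_iff₀' hθ0, Finset.mul_sum]
    have e1 : ∑ j ∈ Finset.range (N + 1), θ * (θ ^ j * ‖(A ^ j) (A x)‖)
        = ∑ j ∈ Finset.range (N + 1), θ ^ (j + 1) * ‖(A ^ (j + 1)) x‖ :=
      Finset.sum_congr rfl fun j _ => by
        rw [pow_succ A, pow_succ' θ, mul_assoc]; rfl
    have e2 := Finset.sum_range_succ' (fun j => θ ^ j * ‖(A ^ j) x‖) (N + 1)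
    have e3 := Finset.sum_range_succ (fun j => θ ^ j * ‖(A ^ j) x‖) (N + 1)
    have e4 : θ ^ (N + 1) * ‖(A ^ (N + 1)) x‖ ≤ ‖x‖ := by
      have h1 := (A ^ (N + 1)).le_opNorm x
      calc θ ^ (N + 1) * ‖(A ^ (N + 1)) x‖ ≤ θ ^ (N + 1) * (‖A ^ (N + 1)‖ * ‖x‖) := by gcongr
        _ = (θ ^ (N + 1) * ‖A ^ (N + 1)‖) * ‖x‖ := by ring
        _ ≤ 1 * ‖x‖ := by gcongr
        _ = ‖x‖ := one_mul _
    rw [e1]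
    simp only [pow_zero, one_mul, one_apply_eq_self] at e2
    linarith
  · exact continuous_finsetSum _ fun j _ => continuous_const.mul (A ^ j).continuous.norm

/-- An attracting fixed point of a strictly differentiable map persists under perturbations of
the parameter, with uniform convergence of the iterates in a neighbourhood. -/
theorem eventually_exists_attracting_fixedPoint {P X : Type*} [NormedAddCommGroup P]
    [NormedSpace ℂ P] [NormedAddCommGroup X] [NormedSpace ℂ X] [CompleteSpace X]
    {F : P × X → X} {L : P × X →L[ℂ] X} {c₀ : P} {d : X}
    (hF : HasStrictFDerivAt F L (c₀, d)) (hd : F (c₀, d) = d) {N : ℕ}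
    (hN : ‖(L ∘L .inr ℂ P X) ^ (N + 1)‖ < 1) {W : Set (P × X)} (hW : W ∈ 𝓝 (c₀, d)) :
    ∀ᶠ c in 𝓝 c₀, ∃ d' : X, ∃ V ∈ 𝓝 d',
      (∀ a ∈ V, ∀ n, (c, (fun a => F (c, a))^[n] a) ∈ W) ∧
      TendstoUniformlyOn (fun n a => (fun a => F (c, a))^[n] a) (fun _ => d') atTop V := by
  obtain ⟨g, C, θ, hC, hθ0, hθ1, hg1, hgC, hadd, hA, hgc⟩ := exists_adapted_norm _ hN
  -- The linear part contracts by `θ` and the nonlinear error is allowed `(1 - θ) / 2`. The constant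
  -- `ε` includes a division by `C` because the error is measured in the original norm.
  set κ : ℝ := (1 + θ) / 2 with hκ
  have hκ0 : 0 < κ := by positivity
  have hκ1 : κ < 1 := by rw [hκ]; linarith
  set ε : ℝ := (1 - θ) / 2 / C with hε
  have hε0 : 0 < ε := by have : 0 < 1 - θ := by linarith
                         positivity
  have hlip : ∀ᶠ p in 𝓝 ((c₀, d), (c₀, d)),
      ‖F p.1 - F p.2 - L (p.1 - p.2)‖ ≤ ε * ‖p.1 - p.2‖ := hF.isLittleO.def hε0
  obtain ⟨s₁, hs₁, hb₁⟩ := Metric.eventually_nhds_iff.1 hlip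
  obtain ⟨s₂, hs₂, hb₂⟩ := Metric.mem_nhds_iff.1 hW
  set s := min s₁ s₂
  have hs : 0 < s := lt_min hs₁ hs₂
  have near {c : P} {x : X} (hc : dist c c₀ < s) (hx : g (x - d) < s) :
      dist (c, x) (c₀, d) < s := by
    rw [Prod.dist_eq]
    exact max_lt hc (by rw [dist_eq_norm]; exact (hg1 _).trans_lt hx)
  have contr {c : P} (hc : dist c c₀ < s) {x y : X} (hx : g (x - d) < s) (hy : g (y - d) < s) :
      g (F (c, x) - F (c, y)) ≤ κ * g (x - y) := by
    have h1 : dist ((c, x), (c, y)) ((c₀, d), (c₀, d)) < s₁ := by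
      rw [Prod.dist_eq]
      exact max_lt ((near hc hx).trans_le (min_le_left _ _))
        ((near hc hy).trans_le (min_le_left _ _))
    have h2 := hb₁ h1
    simp only [Prod.mk_sub_mk, sub_self] at h2
    have h3 : ‖((0 : P), x - y)‖ = ‖x - y‖ := by simp [Prod.norm_def]
    rw [h3] at h2
    have h4 := hadd (L (0, x - y)) (F (c, x) - F (c, y) - L (0, x - y))
    rw [add_sub_cancel] at h4
    have h5 : g (L (0, x - y)) ≤ θ * g (x - y) := hA (x - y)
    have h6 := (hgC _).trans (mul_le_mul_of_nonneg_left h2 hC.le)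
    have h7 : C * (ε * ‖x - y‖) = (1 - θ) / 2 * ‖x - y‖ := by rw [hε]; field_simp
    have h8 := hg1 (x - y)
    rw [h7] at h6
    rw [hκ]
    nlinarith
  -- For nearby parameters `d` moves so little that the `g`-ball of radius `s / 2` about `d` is
  -- mapped into itself.
  have hsmall : ∀ᶠ c in 𝓝 c₀, g (F (c, d) - d) < (1 - κ) * (s / 2) := by
    have h1 : Tendsto (fun c => F (c, d) - d) (𝓝 c₀) (𝓝 (F (c₀, d) - d)) :=
      (hF.continuousAt.tendsto.comp
        ((continuous_id.prodMk continuous_const).tendsto c₀)).sub_const d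
    have h2 := (hgc.tendsto _).comp h1
    refine h2.eventually_lt_const ?_
    have h3 : g (F (c₀, d) - d) ≤ 0 := by simpa [hd] using hgC 0
    have : 0 < 1 - κ := by linarith
    exact h3.trans_lt (by positivity)
  filter_upwards [hsmall, Metric.ball_mem_nhds c₀ hs] with c hc1 hc2
  set f : X → X := fun a => F (c, a)
  have hball {x : X} (hx : g (x - d) ≤ s / 2) : g (f x - d) ≤ s / 2 := by
    have h1 : g (d - d) < s := by
      have := hgC (d - d); simp at this; simpa using this.trans_lt hs
    have h2 := contr hc2 (hx.trans_lt (half_lt_self hs)) h1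
    have h3 := hadd (F (c, x) - F (c, d)) (F (c, d) - d)
    rw [sub_add_sub_cancel] at h3
    change g (F (c, x) - d) ≤ s / 2
    nlinarith
  have hu (n : ℕ) : g (f^[n] d - d) ≤ s / 2 := by
    induction n with
    | zero => have := hgC (d - d); simp at this; simpa using this.trans (by positivity)
    | succ n ih => rw [Function.iterate_succ_apply']; exact hball ih
  have hstep (n : ℕ) : g (f^[n] d - f^[n + 1] d) ≤ g (d - f d) * κ ^ n := by
    induction n with
    | zero => simp
    | succ n ih =>
      rw [Function.iterate_succ_apply', Function.iterate_succ_apply' f (n + 1)]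
      refine (contr hc2 ((hu n).trans_lt (half_lt_self hs))
        ((hu (n + 1)).trans_lt (half_lt_self hs))).trans ?_
      rw [pow_succ]
      nlinarith
  have hcauchy : CauchySeq fun n => f^[n] d :=
    cauchySeq_of_le_geometric κ (g (d - f d)) hκ1 fun n => by
      rw [dist_eq_norm]; exact (hg1 _).trans (hstep n)
  obtain ⟨d', hd'⟩ := cauchySeq_tendsto_of_complete hcauchy
  have hd's : g (d' - d) ≤ s / 2 :=
    le_of_tendsto' ((hgc.tendsto _).comp (hd'.sub_const d)) hu
  have hfix : f d' = d' := by
    have h1 : Tendsto (fun n => f^[n + 1] d) atTop (𝓝 (f d')) := by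
      rw [tendsto_iff_norm_sub_tendsto_zero]
      have h2 : Tendsto (fun n => κ * (C * ‖f^[n] d - d'‖)) atTop (𝓝 0) := by
        simpa using ((tendsto_iff_norm_sub_tendsto_zero.1 hd').const_mul C).const_mul κ
      refine squeeze_zero (fun n => norm_nonneg _) (fun n => ?_) h2
      rw [Function.iterate_succ_apply']
      refine (hg1 _).trans ((contr hc2 ((hu n).trans_lt (half_lt_self hs))
        (hd's.trans_lt (half_lt_self hs))).trans ?_)
      gcongr
      exact hgC _
    exact tendsto_nhds_unique h1 ((tendsto_add_atTop_iff_nat 1).2 hd')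
  have hV {x : X} (hx : g (x - d') < s / 2) : g (x - d) < s := by
    have := hadd (x - d') (d' - d)
    rw [sub_add_sub_cancel] at this
    linarith
  have hd'0 : g (d' - d') ≤ 0 := by simpa using hgC (d' - d')
  have hiter {a : X} (ha : g (a - d') < s / 2) (n : ℕ) :
      g (f^[n] a - d') ≤ κ ^ n * (s / 2) := by
    induction n with
    | zero => simpa using ha.le
    | succ n ih =>
      have h1 : g (f^[n] a - d) < s := by
        rcases n with _ | n
        · exact hV ha
        · refine hV (ih.trans_lt ?_)
          have : κ ^ (n + 1) < 1 := pow_lt_one₀ hκ0.le hκ1 (by omega)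
          nlinarith
      rw [Function.iterate_succ_apply', pow_succ']
      have h2 := contr hc2 h1 (hd's.trans_lt (half_lt_self hs))
      change g (f (f^[n] a) - f d') ≤ _ at h2
      rw [hfix] at h2
      nlinarith
  refine ⟨d', {x | g (x - d') < s / 2}, ?_, fun a ha n => ?_, ?_⟩
  · refine (isOpen_lt (hgc.comp (continuous_id.sub continuous_const)) continuous_const).mem_nhds ?_
    exact hd'0.trans_lt (by positivity)
  · refine hb₂ ((near hc2 ?_).trans_le (min_le_right _ _))
    rcases n with _ | n
    · exact hV ha
    · refine hV ((hiter ha _).trans_lt ?_)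
      have : κ ^ (n + 1) < 1 := pow_lt_one₀ hκ0.le hκ1 (by omega)
      nlinarith
  · rw [Metric.tendstoUniformlyOn_iff]
    intro δ hδ
    have h1 : Tendsto (fun n => κ ^ n * (s / 2)) atTop (𝓝 0) := by
      simpa using (tendsto_pow_atTop_nhds_zero_of_lt_one hκ0.le hκ1).mul_const (s / 2)
    filter_upwards [h1.eventually_lt_const hδ] with n hn a ha
    rw [dist_comm, dist_eq_norm]
    exact ((hg1 _).trans (hiter ha n)).trans_lt hn

/-! ### The smooth renormalization map, and large energies. -/

/-- The renormalization map built from a local choice `E` of unstable sections. -/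
def stepMap (E : ℂ × Coeff → Coeff) (v : ℂ × Coeff) : Coeff :=
  interleave (E (v.1, v.2 ^ 2), v.2 * Ring.inverse (E (v.1, v.2 ^ 2)))

theorem IsUnstableSection.isUnstableStep {E : ℂ × Coeff → Coeff} {c : ℂ} {a : Coeff}
    (h : IsUnstableSection c (a ^ 2) (E (c, a ^ 2))) : IsUnstableStep c a (stepMap E (c, a)) := by
  have e : evenPart (stepMap E (c, a)) = E (c, a ^ 2) := by ext x; simp [stepMap]
  refine ⟨by rwa [e], fun x => ?_⟩
  have := h.ne_zero x
  simp [stepMap, ringInverse_apply h.ne_zero]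
  field_simp

theorem contDiffAt_stepMap {E : ℂ × Coeff → Coeff} {c : ℂ} {a : Coeff}
    (hE : ContDiffAt ℂ 1 E (c, a ^ 2)) (h : ∀ x, E (c, a ^ 2) x ≠ 0) :
    ContDiffAt ℂ 1 (stepMap E) (c, a) := by
  have h1 : ContDiffAt ℂ 1 (fun v : ℂ × Coeff => (v.1, v.2 ^ 2)) (c, a) :=
    contDiffAt_fst.prodMk (contDiffAt_snd.pow 2)
  have h2 : ContDiffAt ℂ 1 (fun v : ℂ × Coeff => E (v.1, v.2 ^ 2)) (c, a) :=
    ContDiffAt.comp (c, a) (g := E) hE h1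
  have h3 : ContDiffAt ℂ 1 (fun v : ℂ × Coeff => Ring.inverse (E (v.1, v.2 ^ 2))) (c, a) :=
    ContDiffAt.comp (c, a) (g := (Ring.inverse : Coeff → Coeff)) (contDiffAt_inverse_coeff h) h2
  exact interleave.contDiff.contDiffAt.comp (c, a) (h2.prodMk (contDiffAt_snd.mul h3))

theorem IsUnstableStep.scale {c : ℂ} {a d : Coeff} (h : IsUnstableStep c a d) {s : ℂ}
    (hs : s ≠ 0) : IsUnstableStep (s ^ 2 * c) (s ^ 2 • a) (s • d) := by
  refine ⟨?_, fun x => ?_⟩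
  · have := h.1.scale hs
    rwa [← map_smul, show s ^ 4 • a ^ 2 = (s ^ 2 • a) ^ 2 by rw [smul_pow, ← pow_mul]] at this
  · have := h.2 x
    simp only [ContinuousMap.smul_apply, smul_eq_mul]
    rw [← this]
    ring

theorem isUnstableSection_neg_one_zero_one : IsUnstableSection (-1) 0 1 where
  ne_zero x := one_ne_zero
  riccati x := by simp
  contracting := ⟨1, fun x => by simp⟩

/-- By homogeneity, conjugation with multiplication by `ε` carries energy `-ε⁻²` to energy `-1` and
the map to `a ↦ stepMap E (-1, ε • a)`. This still makes sense at `ε = 0`, where it is constant, so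
its fixed point has derivative zero and persists. -/
theorem eventually_coeffConverges_neg_inv_sq :
    ∀ᶠ ε : ℂ in 𝓝 0, ε ≠ 0 → CoeffConverges (-(ε⁻¹) ^ 2) := by
  obtain ⟨E, hE0, hE, hsec⟩ := isUnstableSection_neg_one_zero_one.exists_local
  set F : ℂ × Coeff → Coeff := fun v => stepMap E (-1, v.1 • v.2)
  set d : Coeff := stepMap E (-1, 0)
  have hd (a : Coeff) : F (0, a) = d := by simp [F, d]
  have h1 : ContDiffAt ℂ 1 (fun v : ℂ × Coeff => ((-1 : ℂ), v.1 • v.2)) (0, d) :=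
    contDiffAt_const.prodMk (contDiffAt_fst.smul contDiffAt_snd)
  have h2 : ContDiffAt ℂ 1 (stepMap E) (-1, (0 : ℂ) • d) := by
    rw [zero_smul]
    refine contDiffAt_stepMap ?_ ?_
    · rwa [zero_pow two_ne_zero]
    · rw [zero_pow two_ne_zero, hE0]
      exact isUnstableSection_neg_one_zero_one.ne_zero
  have h3 : ContDiffAt ℂ 1 F (0, d) := ContDiffAt.comp (0, d) (g := stepMap E) h2 h1
  have h4 := h3.hasStrictFDerivAt one_ne_zero
  have h5 : fderiv ℂ F (0, d) ∘L .inr ℂ ℂ Coeff = 0 := by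
    have h6 : HasFDerivAt (fun a : Coeff => F (0, a)) (fderiv ℂ F (0, d) ∘L .inr ℂ ℂ Coeff) d :=
      h4.hasFDerivAt.comp d (hasFDerivAt_prodMk_right 0 d)
    simp only [hd] at h6
    exact h6.unique (hasFDerivAt_const d d)
  have hW : {v : ℂ × Coeff | IsUnstableSection (-1) ((v.1 • v.2) ^ 2) (E (-1, (v.1 • v.2) ^ 2))}
      ∈ 𝓝 ((0 : ℂ), d) := by
    have h7 : Tendsto (fun v : ℂ × Coeff => ((-1 : ℂ), (v.1 • v.2) ^ 2)) (𝓝 (0, d))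
        (𝓝 (-1, 0)) := by
      have : Continuous fun v : ℂ × Coeff => ((-1 : ℂ), (v.1 • v.2) ^ 2) := by fun_prop
      simpa using this.tendsto (0, d)
    exact h7.eventually hsec
  have h8 := eventually_exists_attracting_fixedPoint (N := 0) h4 (hd d)
    (by rw [h5]; simp) hW
  filter_upwards [h8] with ε h9 hε
  obtain ⟨d', V, hV, hVW, hlim⟩ := h9
  set f : Coeff → Coeff := fun a => F (ε, a)
  refine ⟨ε⁻¹ • d', (fun a => ε • a) ⁻¹' V, ?_, fun n a => ε⁻¹ • f^[n] (ε • a),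
    fun a ha => ⟨?_, fun n => ?_⟩, ?_⟩
  · refine (continuous_const_smul ε).continuousAt.preimage_mem_nhds ?_
    simpa [smul_smul, hε] using hV
  · simp [smul_smul, hε]
  · have h10 : IsUnstableSection (-1) ((ε • f^[n] (ε • a)) ^ 2)
      (E (-1, (ε • f^[n] (ε • a)) ^ 2)) := hVW _ ha n
    have h11 := h10.isUnstableStep.scale (inv_ne_zero hε)
    beta_reduce
    rw [Function.iterate_succ_apply']
    have e1 : (ε⁻¹ ^ 2 * -1 : ℂ) = -(ε⁻¹) ^ 2 := by ring
    have e2 : ε⁻¹ ^ 2 • ε • f^[n] (ε • a) = ε⁻¹ • f^[n] (ε • a) := by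
      rw [smul_smul]; congr 1; field_simp
    rwa [e1, e2] at h11
  · rw [Metric.tendstoUniformlyOn_iff] at hlim ⊢
    intro δ hδ
    have h12 : 0 < ‖ε‖ := norm_pos_iff.2 hε
    filter_upwards [hlim (‖ε‖ * δ) (by positivity)] with n hn a ha
    have := hn _ ha
    rw [dist_smul₀, norm_inv, inv_mul_lt_iff₀ h12]
    exact this

theorem isBounded_not_coeffConverges : Bornology.IsBounded {c | ¬ CoeffConverges c} := by
  obtain ⟨δ, hδ, h⟩ := Metric.eventually_nhds_iff.1 eventually_coeffConverges_neg_inv_sq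
  refine (Metric.isBounded_closedBall (x := (0 : ℂ)) (r := (δ⁻¹) ^ 2)).subset fun c hc => ?_
  by_contra hcb
  apply hc
  rw [mem_closedBall_zero_iff, not_le] at hcb
  obtain ⟨s, hs⟩ := IsAlgClosed.exists_pow_nat_eq (-c) (n := 2) two_pos
  have h1 : δ⁻¹ < ‖s‖ := by
    refine lt_of_pow_lt_pow_left₀ 2 (norm_nonneg s) ?_
    rwa [← norm_pow, hs, norm_neg]
  have h2 : 0 < ‖s‖ := lt_trans (by positivity) h1
  have h3 := h (y := s⁻¹) (by
    rw [dist_zero_right, norm_inv]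
    exact inv_lt_of_inv_lt₀ hδ h1) (inv_ne_zero (norm_pos_iff.1 h2))
  rwa [inv_inv, hs, neg_neg] at h3

/-! ### Convergence is an open condition on the energy. -/

theorem IsUnstableSection.of_sq_eq {c : ℂ} {b e e' : Coeff} (h : IsUnstableSection c b e)
    (he : e ^ 2 = e' ^ 2) : IsUnstableSection c b e' := by
  have h1 (x : ℤ_[2]) : e x ^ 2 = e' x ^ 2 := congrArg (fun f : Coeff => f x) he
  have h2 (x : ℤ_[2]) : ‖e' x‖ ^ 4 = ‖e x‖ ^ 4 := by
    have := congrArg (fun z => ‖z‖ ^ 2) (h1 x)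
    simp only [norm_pow, ← pow_mul] at this
    exact this.symm
  refine ⟨fun x hx => h.ne_zero x ?_, fun x => ?_, ?_⟩
  · have := h1 x
    rwa [hx, zero_pow two_ne_zero, sq_eq_zero_iff] at this
  · rw [← h1, ← h1, h.riccati]
  · simpa only [h2] using h.contracting

/-- A limit of the iterates is a fixed point of the renormalization map. -/
theorem isUnstableStep_of_tendsto {c : ℂ} {d : Coeff} {Φ : ℕ → Coeff} (h0 : Φ 0 = d)
    (h : ∀ n, IsUnstableStep c (Φ n) (Φ (n + 1))) (hlim : Tendsto Φ atTop (𝓝 d)) :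
    IsUnstableStep c d d := by
  have hd : IsUnstableSection c (d ^ 2) (evenPart (Φ 1)) := by
    have := (h 0).1
    rwa [h0] at this
  have hlim1 : Tendsto (fun n => Φ (n + 1)) atTop (𝓝 d) := (tendsto_add_atTop_iff_nat 1).2 hlim
  -- Contraction need not pass to a limit, so it is taken from `Φ 1`, a section for `d ^ 2` because
  -- `Φ 0 = d`. Its continuation `E` must agree up to sign with the later iterates, which identifies
  -- the squares in the limit.
  obtain ⟨E, hE0, hE, hsec⟩ := hd.exists_local
  have h1 : Tendsto (fun n => (c, Φ n ^ 2)) atTop (𝓝 (c, d ^ 2)) :=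
    tendsto_const_nhds.prodMk_nhds (hlim.pow 2)
  have h2 : Tendsto (fun n => E (c, Φ n ^ 2) ^ 2) atTop (𝓝 (evenPart (Φ 1) ^ 2)) := by
    have := (hE.continuousAt.tendsto.comp h1).pow 2
    rwa [hE0] at this
  have h3 : Tendsto (fun n => evenPart (Φ (n + 1)) ^ 2) atTop (𝓝 (evenPart d ^ 2)) :=
    ((evenPart.continuous.tendsto d).comp hlim1).pow 2
  have h4 : evenPart (Φ 1) ^ 2 = evenPart d ^ 2 := by
    refine tendsto_nhds_unique (h2.congr' ?_) h3
    filter_upwards [h1.eventually hsec] with n hn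
    exact hn.sq_unique (h n).1
  refine ⟨hd.of_sq_eq h4, fun x => ?_⟩
  have ev (y : ℤ_[2]) {Ψ : ℕ → Coeff} (hΨ : Tendsto Ψ atTop (𝓝 d)) :
      Tendsto (fun n => Ψ n y) atTop (𝓝 (d y)) :=
    ((continuous_eval_const (F := Coeff) y).tendsto d).comp hΨ
  refine tendsto_nhds_unique (((ev (2 * x) hlim1).mul (ev (2 * x + 1) hlim1)).congr fun n => ?_)
    (ev x hlim)
  exact (h n).2 x

theorem tendsto_two_pow_mul_sub_one {d : Coeff} (hd : d (-1) = 0) {η : ℝ} (hη : 0 < η) :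
    ∃ k₀ : ℕ, ∀ k ≥ k₀, ∀ w : ℤ_[2], ‖d (2 ^ k * w - 1)‖ ≤ η := by
  obtain ⟨δ, hδ, h⟩ := Metric.continuousAt_iff.1 (d.continuous.continuousAt (x := -1)) η hη
  obtain ⟨k₀, hk₀⟩ := exists_pow_lt_of_lt_one hδ (one_half_lt_one (α := ℝ))
  refine ⟨k₀, fun k hk w => ?_⟩
  have h1 : dist (2 ^ k * w - 1 : ℤ_[2]) (-1) < δ := by
    rw [dist_eq_norm, sub_neg_eq_add, sub_add_cancel, norm_mul, norm_pow]
    have h2 : ‖(2 : ℤ_[2])‖ = 1 / 2 := by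
      have := PadicInt.norm_p (p := 2)
      push_cast at this
      rw [this]; norm_num
    rw [h2]
    calc (1 / 2 : ℝ) ^ k * ‖w‖ ≤ (1 / 2) ^ k * 1 := by gcongr; exact PadicInt.norm_le_one w
      _ ≤ (1 / 2) ^ k₀ := by
        rw [mul_one]; exact pow_le_pow_of_le_one (by norm_num) (by norm_num) hk
      _ < δ := hk₀
  have h3 := h h1
  rw [hd, dist_zero_right] at h3
  exact h3.le

/-- The places where the sign of the square root is not determined by continuity: either there
are none, or the fixed point `d` is small there. -/
theorem exists_sign_sets {d : Coeff} (hd : ∀ x, d (2 * x) ≠ 0)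
    (hprod : ∀ x, d (2 * x) * d (2 * x + 1) = d x) :
    ∃ (S : ℕ → Set ℤ_[2]) (μ : ℝ), 0 < μ ∧ (∀ x, x ∈ S 0 ∨ μ ≤ ‖d x‖) ∧
      (∀ k, ∀ y ∈ S k, 2 * y + 1 ∈ S (k + 1)) ∧
      ∀ η > 0, ∃ k₀ : ℕ, ∀ k ≥ k₀, ∀ x ∈ S k, ‖d x‖ ≤ η := by
  by_cases h : d (-1) = 0
  -- The odd branch `y ↦ 2y + 1` contracts to `-1`: these sets start with everything and shrink to
  -- `-1`, where `d` vanishes.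
  · refine ⟨fun k => Set.range fun w => 2 ^ k * w - 1, 1, one_pos,
      fun x => Or.inl ⟨x + 1, by simp⟩, ?_, fun η hη => ?_⟩
    · rintro k _ ⟨w, rfl⟩
      exact ⟨w, by ring⟩
    · obtain ⟨k₀, hk₀⟩ := tendsto_two_pow_mul_sub_one h hη
      refine ⟨k₀, ?_⟩
      rintro k hk _ ⟨w, rfl⟩
      exact hk₀ k hk w
  -- A zero at `x` propagates along `y ↦ 2y + 1` to points tending to `-1`, so `d(-1) ≠ 0` excludes
  -- all zeros.
  · have hne : ∀ x, d x ≠ 0 := by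
      intro x hx
      have h1 (k : ℕ) : d (2 ^ k * (x + 1) - 1) = 0 := by
        induction k with
        | zero => simpa using hx
        | succ k ih =>
          have h2 := hprod (2 ^ k * (x + 1) - 1)
          rw [ih] at h2
          have h3 := (mul_eq_zero.1 h2).resolve_left (hd _)
          rw [← h3]; congr 1; ring
      have h4 : Tendsto (fun k : ℕ => (2 : ℤ_[2]) ^ k * (x + 1) - 1) atTop (𝓝 (0 * (x + 1) - 1)) := by
        refine ((tendsto_pow_atTop_nhds_zero_of_norm_lt_one ?_).mul_const _).sub_const 1
        have := PadicInt.norm_p (p := 2)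
        push_cast at this
        rw [this]; norm_num
      rw [zero_mul, zero_sub] at h4
      have h5 := (d.continuous.tendsto _).comp h4
      exact h (tendsto_nhds_unique h5 (tendsto_const_nhds.congr fun k => (h1 k).symm))
    obtain ⟨m, hm, hm'⟩ := exists_pos_le_norm_of_ne_zero hne
    exact ⟨fun _ => ∅, m, hm, fun x => Or.inr (hm' x), fun _ _ h => h.elim,
      fun η _ => ⟨0, fun _ _ _ h => h.elim⟩⟩

theorem eq_of_sq_eq_of_near {z w v : ℂ} (h : z ^ 2 = w ^ 2)
    (hzw : ‖z - v‖ + ‖w - v‖ < 2 * ‖v‖) : z = w := by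
  rcases sq_eq_sq_iff_eq_or_eq_neg.1 h with h1 | h1
  · exact h1
  · exfalso
    have h2 : (2 : ℂ) * v = -((z - v) + (w - v)) := by rw [h1]; ring
    have h3 := norm_add_le (z - v) (w - v)
    have h4 := congrArg norm h2
    rw [norm_mul, norm_neg, Complex.norm_two] at h4
    linarith

theorem evenPart_stepMap (E : ℂ × Coeff → Coeff) (v : ℂ × Coeff) :
    evenPart (stepMap E v) = E (v.1, v.2 ^ 2) := by
  ext x; simp [stepMap]

theorem norm_apply_sub_le (f g : Coeff) (x : ℤ_[2]) : ‖f x - g x‖ ≤ ‖f - g‖ :=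
  (f - g).norm_coe_le_norm x

theorem IsUnstableStep.sq_unique {c : ℂ} {a a' d d' : Coeff} (h : IsUnstableStep c a d)
    (h' : IsUnstableStep c a' d') (ha : a ^ 2 = a' ^ 2) : d ^ 2 = d' ^ 2 := by
  have h1 := h.1
  rw [ha] at h1
  have h2 (x : ℤ_[2]) : d (2 * x) ^ 2 = d' (2 * x) ^ 2 :=
    congrArg (fun f : Coeff => f x) (h1.sq_unique h'.1)
  refine coeff_ext_parity h2 fun x => ?_
  have h3 := congrArg (fun f : Coeff => f x) ha
  simp only [ContinuousMap.pow_apply] at h3 ⊢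
  rw [← h.2 x, ← h'.2 x, mul_pow, mul_pow, ← h2] at h3
  exact mul_left_cancel₀ (pow_ne_zero 2 (h.1.ne_zero x)) h3

/-- If the iterates of the renormalization map converge, then so do those of the continuous
branch `stepMap E` through the fixed point. -/
theorem exists_ball_iterate_stepMap {c : ℂ} {d : Coeff} (hdd : IsUnstableStep c d d)
    {U : Set Coeff} (hU : U ∈ 𝓝 d) {Φ : ℕ → Coeff → Coeff}
    (hΦ : ∀ a ∈ U, Φ 0 a = a ∧ ∀ n, IsUnstableStep c (Φ n a) (Φ (n + 1) a))
    (hlim : TendstoUniformlyOn Φ (fun _ => d) atTop U)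
    {E : ℂ × Coeff → Coeff} (hE0 : E (c, d ^ 2) = evenPart d)
    (hE : ContDiffAt ℂ 1 E (c, d ^ 2))
    (hsec : ∀ᶠ v in 𝓝 (c, d ^ 2), IsUnstableSection v.1 v.2 (E v))
    (hfd : stepMap E (c, d) = d) :
    ∃ r > 0,
      (∀ a ∈ Metric.ball d r, ∀ n,
        DifferentiableAt ℂ (fun a => stepMap E (c, a)) ((fun a => stepMap E (c, a))^[n] a)) ∧
      ∃ N : ℕ, ∀ a ∈ Metric.ball d r, ‖(fun a => stepMap E (c, a))^[N + 1] a - d‖ ≤ r / 8 := by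
  set f : Coeff → Coeff := fun a => stepMap E (c, a)
  obtain ⟨m, hm, hm'⟩ := exists_pos_le_norm_of_ne_zero hdd.1.ne_zero
  obtain ⟨S, μ, hμ, hS0, hS, hSsmall⟩ := exists_sign_sets hdd.1.ne_zero hdd.2
  have hfc : ContinuousAt f d := by
    have h1 : ContDiffAt ℂ 1 (stepMap E) (c, d) :=
      contDiffAt_stepMap hE (by rw [hE0]; exact hdd.1.ne_zero)
    exact ContinuousAt.comp (g := stepMap E) h1.continuousAt
      (continuous_const.prodMk continuous_id).continuousAt
  have hgood : ∀ᶠ b in 𝓝 (d ^ 2), ContDiffAt ℂ 1 E (c, b) ∧ IsUnstableSection c b (E (c, b)) ∧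
      ‖E (c, b) - evenPart d‖ < m := by
    have h1 : Tendsto (fun b : Coeff => (c, b)) (𝓝 (d ^ 2)) (𝓝 (c, d ^ 2)) :=
      (continuous_const.prodMk continuous_id).tendsto _
    have h2 : Tendsto (fun b : Coeff => ‖E (c, b) - evenPart d‖) (𝓝 (d ^ 2)) (𝓝 0) := by
      have := ((hE.continuousAt.tendsto.comp h1).sub_const (evenPart d)).norm
      simpa [hE0] using this
    exact (h1.eventually (hE.eventually (by simp))).and
      ((h1.eventually hsec).and (h2.eventually_lt_const hm))
  obtain ⟨ρ, hρ, hgood⟩ := Metric.eventually_nhds_iff.1 hgood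
  obtain ⟨ε₁, hε₁, hsq⟩ := Metric.continuousAt_iff.1
    ((continuous_pow 2).continuousAt (x := d)) ρ hρ
  -- The three bounds serve to stay in the domain of the branch `E`, to fix signs at even points,
  -- and to fix signs initially outside `S 0`.
  set ε := min ε₁ (min m μ)
  have hε : 0 < ε := lt_min hε₁ (lt_min hm hμ)
  rw [Metric.tendstoUniformlyOn_iff] at hlim
  obtain ⟨n₀, hn₀⟩ := eventually_atTop.1 (hlim ε hε)
  have hsmall : ∀ᶠ a in 𝓝 d, ∀ n ∈ Finset.range (n₀ + 1), dist (f^[n] a) d < ε := by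
    rw [Filter.eventually_all_finset]
    intro n _
    have h1 : ContinuousAt f^[n] d := hfc.iterate hfd n
    have h2 : f^[n] d = d := Function.iterate_fixed hfd n
    have h3 := h1.eventually (Metric.ball_mem_nhds _ hε)
    rwa [h2] at h3
  obtain ⟨r, hr, hball⟩ := Metric.mem_nhds_iff.1 (hsmall.and hU)
  -- The branch `E` sees only squares, and squares do not depend on the choice of signs. So the
  -- smooth iterates stay in its domain: by continuity up to time `n₀`, and by convergence of `Φ`
  -- afterwards.
  have inv {a : Coeff} (ha : a ∈ Metric.ball d r) (n : ℕ) :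
      f^[n] a ^ 2 = Φ n a ^ 2 ∧ dist (f^[n] a ^ 2) (d ^ 2) < ρ := by
    have haU := (hball ha).2
    have near (n : ℕ) (h : f^[n] a ^ 2 = Φ n a ^ 2) : dist (f^[n] a ^ 2) (d ^ 2) < ρ := by
      rcases le_or_gt n n₀ with hn | hn
      · exact hsq (((hball ha).1 n (Finset.mem_range.2 (by omega))).trans_le (min_le_left _ _))
      · rw [h]
        have := hn₀ n hn.le a haU
        rw [dist_comm] at this
        exact hsq (this.trans_le (min_le_left _ _))
    induction n with
    | zero =>
      have h1 : f^[0] a ^ 2 = Φ 0 a ^ 2 := by rw [(hΦ a haU).1]; rfl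
      exact ⟨h1, near 0 h1⟩
    | succ n ih =>
      have h1 : f^[n + 1] a ^ 2 = Φ (n + 1) a ^ 2 := by
        rw [Function.iterate_succ_apply']
        exact (hgood ih.2).2.1.isUnstableStep.sq_unique ((hΦ a haU).2 n) ih.1
      exact ⟨h1, near _ h1⟩
  have sqx {a : Coeff} (ha : a ∈ Metric.ball d r) (n : ℕ) (x : ℤ_[2]) :
      f^[n] a x ^ 2 = Φ n a x ^ 2 := congrArg (fun g : Coeff => g x) (inv ha n).1
  have hΦε {a : Coeff} (ha : a ∈ Metric.ball d r) {n : ℕ} (hn : n₀ ≤ n) : ‖Φ n a - d‖ < ε := by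
    have := hn₀ n hn a (hball ha).2
    rwa [dist_comm, dist_eq_norm] at this
  have evens {a : Coeff} (ha : a ∈ Metric.ball d r) {n : ℕ} (hn : n₀ ≤ n) (y : ℤ_[2]) :
      f^[n + 1] a (2 * y) = Φ (n + 1) a (2 * y) := by
    refine eq_of_sq_eq_of_near (v := d (2 * y)) (sqx ha _ _) ?_
    have h1 : ‖f^[n + 1] a (2 * y) - d (2 * y)‖ < m := by
      have h2 := (hgood (inv ha n).2).2.2
      have h3 := evenPart_stepMap E (c, f^[n] a)
      rw [← h3] at h2
      rw [Function.iterate_succ_apply']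
      exact (norm_apply_sub_le _ _ y).trans_lt h2
    have h4 : ‖Φ (n + 1) a (2 * y) - d (2 * y)‖ < m :=
      (norm_apply_sub_le _ _ _).trans_lt ((hΦε ha (by omega)).trans_le
        ((min_le_right _ _).trans (min_le_left _ _)))
    have h5 : m ≤ ‖d (2 * y)‖ := hm' y
    linarith
  -- Even values have the right sign since `d` is bounded away from zero there. The product equation
  -- passes agreement at `y` on to `2y + 1`, so disagreement can survive only on `S k`.
  have signs {a : Coeff} (ha : a ∈ Metric.ball d r) (k : ℕ) (x : ℤ_[2]) :
      x ∈ S k ∨ f^[n₀ + k] a x = Φ (n₀ + k) a x := by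
    induction k generalizing x with
    | zero =>
      refine (hS0 x).imp_right fun hx => ?_
      refine eq_of_sq_eq_of_near (v := d x) (sqx ha _ _) ?_
      have h1 := (hball ha).1 n₀ (Finset.mem_range.2 (by omega))
      rw [dist_eq_norm] at h1
      have h2 := norm_apply_sub_le (f^[n₀] a) d x
      have h3 := norm_apply_sub_le (Φ n₀ a) d x
      have h4 := hΦε ha le_rfl
      have h5 : ε ≤ μ := (min_le_right _ _).trans (min_le_right _ _)
      rw [add_zero]
      linarith
    | succ k ih =>
      rcases dyadic_even_or_odd x with ⟨y, rfl⟩ | ⟨y, rfl⟩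
      · exact Or.inr (evens ha (Nat.le_add_right n₀ k) y)
      · refine (ih y).imp (hS k y) fun h => ?_
        have h1 := (hgood (inv ha (n₀ + k)).2).2.1.isUnstableStep
        have h2 := (hΦ a (hball ha).2).2 (n₀ + k)
        have h3 := h1.2 y
        change f (f^[n₀ + k] a) (2 * y) * f (f^[n₀ + k] a) (2 * y + 1) = _ at h3
        rw [← Function.iterate_succ_apply' f, h, ← h2.2 y,
          evens ha (Nat.le_add_right n₀ k) y] at h3
        exact mul_left_cancel₀ (h2.1.ne_zero y) h3
  refine ⟨r, hr, fun a ha n => ?_, ?_⟩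
  · have h1 := hgood (inv ha n).2
    have h2 := (contDiffAt_stepMap h1.1 h1.2.1.ne_zero).differentiableAt one_ne_zero
    exact DifferentiableAt.comp (f^[n] a) (g := stepMap E) h2
      ((differentiableAt_const c).prodMk differentiableAt_id)
  -- A wrong sign costs at most `2 ‖d x‖` beyond the convergence error, in total `3r / 32 < r / 8`.
  · obtain ⟨k₀, hk₀⟩ := hSsmall (r / 32) (by positivity)
    obtain ⟨n₁, hn₁⟩ := eventually_atTop.1 (hlim (r / 32) (by positivity))
    refine ⟨n₀ + (k₀ + n₁), fun a ha => (ContinuousMap.norm_le _ (by positivity)).2 fun x => ?_⟩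
    have h1 : ‖Φ (n₀ + (k₀ + n₁ + 1)) a - d‖ < r / 32 := by
      have := hn₁ (n₀ + (k₀ + n₁ + 1)) (by omega) a (hball ha).2
      rwa [dist_comm, dist_eq_norm] at this
    have h2 := norm_apply_sub_le (Φ (n₀ + (k₀ + n₁ + 1)) a) d x
    change ‖f^[n₀ + (k₀ + n₁ + 1)] a x - d x‖ ≤ r / 8
    rcases signs ha (k₀ + n₁ + 1) x with h3 | h3
    · have h4 := hk₀ _ (by omega) x h3
      rcases sq_eq_sq_iff_eq_or_eq_neg.1 (sqx ha (n₀ + (k₀ + n₁ + 1)) x) with h5 | h5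
      · rw [h5]; linarith
      · rw [h5]
        have h6 : -Φ (n₀ + (k₀ + n₁ + 1)) a x - d x
            = -(Φ (n₀ + (k₀ + n₁ + 1)) a x - d x) - (d x + d x) := by ring
        rw [h6]
        have h7 := norm_sub_le (-(Φ (n₀ + (k₀ + n₁ + 1)) a x - d x)) (d x + d x)
        have h8 := norm_add_le (d x) (d x)
        rw [norm_neg] at h7
        linarith
    · rw [h3]; linarith

/-- On the complex line `ζ ↦ d + ζ • h` the `N`-th iterate is holomorphic with derivative `A ^ N h`
at `0`. Cauchy's estimate on the circle of radius `r / (2 ‖h‖)` bounds this by `‖h‖ / 4`. -/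
theorem norm_pow_fderiv_lt_one {X : Type*} [NormedAddCommGroup X] [NormedSpace ℂ X]
    [CompleteSpace X] {f : X → X} {A : X →L[ℂ] X} {d : X} (hA : HasFDerivAt f A d) (hd : f d = d)
    {r : ℝ} (hr : 0 < r) (hdiff : ∀ a ∈ Metric.ball d r, ∀ n, DifferentiableAt ℂ f (f^[n] a))
    {N : ℕ} (hN : ∀ a ∈ Metric.ball d r, ‖f^[N] a - d‖ ≤ r / 8) : ‖A ^ N‖ < 1 := by
  refine lt_of_le_of_lt (ContinuousLinearMap.opNorm_le_bound _ (by norm_num) fun h => ?_)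
    one_half_lt_one
  rcases eq_or_ne h 0 with rfl | hh
  · simp
  have hh' : 0 < ‖h‖ := norm_pos_iff.2 hh
  have hdiffN (a : X) (ha : a ∈ Metric.ball d r) (n : ℕ) : DifferentiableAt ℂ f^[n] a := by
    induction n with
    | zero => exact differentiableAt_id
    | succ n ih =>
      rw [Function.iterate_succ']
      exact (hdiff a ha n).comp a ih
  set R := r / (2 * ‖h‖)
  have hR : 0 < R := by positivity
  have hmem (ζ : ℂ) (hζ : ζ ∈ Metric.closedBall (0 : ℂ) R) : d + ζ • h ∈ Metric.ball d r := by
    rw [mem_closedBall_zero_iff] at hζ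
    rw [mem_ball_iff_norm, add_sub_cancel_left, norm_smul]
    calc ‖ζ‖ * ‖h‖ ≤ R * ‖h‖ := by gcongr
      _ = r / 2 := by simp only [R]; field_simp
      _ < r := half_lt_self hr
  set g : ℂ → X := fun ζ => f^[N] (d + ζ • h) - d
  have hg : DifferentiableOn ℂ g (Metric.closedBall 0 R) := fun ζ hζ => by
    have h1 := hdiffN _ (hmem ζ hζ) N
    have h2 : DifferentiableAt ℂ (fun ζ : ℂ => d + ζ • h) ζ := by fun_prop
    exact ((DifferentiableAt.comp ζ (g := f^[N]) h1 h2).sub_const d).differentiableWithinAt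
  have hderiv : HasDerivAt g ((A ^ N) h) 0 := by
    have h1 : HasFDerivAt f^[N] (A ^ N) (d + (0 : ℂ) • h) := by
      rw [zero_smul, add_zero]; exact hA.iterate hd N
    have h2 : HasDerivAt (fun ζ : ℂ => d + ζ • h) h 0 := by
      simpa using ((hasDerivAt_id (0 : ℂ)).smul_const h).const_add d
    exact (h1.comp_hasDerivAt 0 h2).sub_const d
  have h3 := Complex.norm_deriv_le_of_forall_mem_sphere_norm_le hR
    (hg.diffContOnCl_ball subset_rfl)
    (fun ζ hζ => hN _ (hmem ζ (Metric.sphere_subset_closedBall hζ)))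
  rw [hderiv.deriv] at h3
  refine h3.trans ?_
  simp only [R]
  rw [div_div_eq_mul_div, div_le_iff₀ hr]
  nlinarith

theorem isOpen_coeffConverges : IsOpen {c | CoeffConverges c} := by
  rw [isOpen_iff_mem_nhds]
  rintro c₀ ⟨d, U, hU, Φ, hΦ, hlim⟩
  have hdU := mem_of_mem_nhds hU
  have hdd : IsUnstableStep c₀ d d :=
    isUnstableStep_of_tendsto (Φ := fun n => Φ n d) (hΦ d hdU).1 (hΦ d hdU).2
      (hlim.tendsto_at hdU)
  obtain ⟨E, hE0, hE, hsec⟩ := hdd.1.exists_local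
  have hfd : stepMap E (c₀, d) = d := by
    refine coeff_ext_parity (fun x => ?_) fun x => ?_
    · simp [stepMap, hE0]
    · have := hdd.1.ne_zero x
      rw [evenPart_apply] at this
      simp [stepMap, hE0, ringInverse_apply hdd.1.ne_zero]
      rw [← hdd.2 x]
      field_simp
  obtain ⟨r, hr, hdiff, N, hN⟩ :=
    exists_ball_iterate_stepMap hdd hU hΦ hlim hE0 hE hsec hfd
  have hF := (contDiffAt_stepMap hE (by rw [hE0]; exact hdd.1.ne_zero)).hasStrictFDerivAt
    one_ne_zero
  have hA : HasFDerivAt (fun a => stepMap E (c₀, a))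
      (fderiv ℂ (stepMap E) (c₀, d) ∘L .inr ℂ ℂ Coeff) d :=
    hF.hasFDerivAt.comp d (hasFDerivAt_prodMk_right c₀ d)
  have hW : {v : ℂ × Coeff | IsUnstableSection v.1 (v.2 ^ 2) (E (v.1, v.2 ^ 2))}
      ∈ 𝓝 (c₀, d) := by
    have h1 : Tendsto (fun v : ℂ × Coeff => (v.1, v.2 ^ 2)) (𝓝 (c₀, d)) (𝓝 (c₀, d ^ 2)) :=
      (continuous_fst.prodMk (continuous_snd.pow 2)).tendsto _
    exact h1.eventually hsec
  filter_upwards [eventually_exists_attracting_fixedPoint hF hfd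
    (norm_pow_fderiv_lt_one hA hfd hr hdiff hN) hW] with c hc
  obtain ⟨d', V, hV, hVW, hlim'⟩ := hc
  refine ⟨d', V, hV, fun n a => (fun a => stepMap E (c, a))^[n] a, fun a ha => ⟨rfl, fun n => ?_⟩,
    hlim'⟩
  beta_reduce
  rw [Function.iterate_succ_apply']
  exact IsUnstableSection.isUnstableStep (hVW a ha n)

/-! ### Orthogonal polynomials of a fixed point and the Mandelbrot set. -/

/-- The solution of `u (n + 2) = z u (n + 1) - r n * u n` with `u 0 = 1` and `u 1 = z`: the monic
orthogonal polynomials of the half-line Jacobi operator with squared coefficients `r`. -/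
def halfLinePolynomial (r : ℕ → ℂ) (z : ℂ) : ℕ → ℂ
  | 0 => 1
  | 1 => z
  | n + 2 => z * halfLinePolynomial r z (n + 1) - r n * halfLinePolynomial r z n

/-- Three consecutive recurrences eliminate the odd-indexed polynomials, and `hmul` and `hadd` turn
the result into the recurrence at energy `z ^ 2 + c`. The value `-c` of `r 0` makes the boundary
term fit: `P_2(z) = z ^ 2 + c`. -/
theorem halfLinePolynomial_two_mul {r : ℕ → ℂ} {c : ℂ} (h0 : r 0 = -c)
    (hmul : ∀ n, r (2 * n) * r (2 * n + 1) = r n) (hadd : ∀ n, r (2 * n + 2) + r (2 * n + 1) = -c)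
    (z : ℂ) (n : ℕ) :
    halfLinePolynomial r z (2 * n) = halfLinePolynomial r (z ^ 2 + c) n := by
  induction n using Nat.twoStepInduction with
  | zero => rfl
  | one => simp [halfLinePolynomial, h0]; ring
  | more n ih0 ih1 =>
    have e0 : halfLinePolynomial r z (2 * (n + 1)) = z * halfLinePolynomial r z (2 * n + 1)
      - r (2 * n) * halfLinePolynomial r z (2 * n) := rfl
    have e1 : halfLinePolynomial r z (2 * n + 3) = z * halfLinePolynomial r z (2 * (n + 1))
      - r (2 * n + 1) * halfLinePolynomial r z (2 * n + 1) := rfl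
    have e2 : halfLinePolynomial r z (2 * (n + 2)) = z * halfLinePolynomial r z (2 * n + 3)
      - r (2 * n + 2) * halfLinePolynomial r z (2 * (n + 1)) := rfl
    have e3 : halfLinePolynomial r (z ^ 2 + c) (n + 2)
      = (z ^ 2 + c) * halfLinePolynomial r (z ^ 2 + c) (n + 1)
        - r n * halfLinePolynomial r (z ^ 2 + c) n := rfl
    rw [e3, ← ih0, ← ih1, e2, e1]
    have h1 := hadd n
    have h2 := hmul n
    linear_combination r (2 * n + 1) * e0 - halfLinePolynomial r z (2 * (n + 1)) * h1
      - halfLinePolynomial r z (2 * n) * h2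

theorem halfLinePolynomial_two_pow {r : ℕ → ℂ} {c : ℂ} (h0 : r 0 = -c)
    (hmul : ∀ n, r (2 * n) * r (2 * n + 1) = r n) (hadd : ∀ n, r (2 * n + 2) + r (2 * n + 1) = -c)
    (n : ℕ) (z : ℂ) :
    halfLinePolynomial r z (2 ^ n) = (fun z : ℂ => z ^ 2 + c)^[n] z := by
  induction n generalizing z with
  | zero => rfl
  | succ n ih =>
    rw [pow_succ', halfLinePolynomial_two_mul h0 hmul hadd, ih, Function.iterate_succ_apply]

/-- The squared coefficients of a fixed point along the positive half-orbit of `0`. -/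
structure IsFixedSequence (c : ℂ) (b : ℕ → ℂ) : Prop where
  ne_zero : ∀ n, b (2 * n) ≠ 0
  mul : ∀ n, b (2 * n) * b (2 * n + 1) = b n
  add : ∀ n, b (2 * n + 2) + b (2 * n + 1) = -c

namespace IsFixedSequence

variable {c : ℂ} {b : ℕ → ℂ}

theorem apply_one (h : IsFixedSequence c b) : b 1 = 1 := by
  have h1 := h.mul 0
  rw [mul_zero, zero_add] at h1
  exact mul_left_cancel₀ (h.ne_zero 0) (h1.trans (mul_one _).symm)

/-- At energy `c` the second-order recurrence admits a first-order one, reflecting the factorization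
`b(n) = b(2n) b(2n+1)`. The modified boundary value is compatible with it because `b 1 = 1`. -/
theorem halfLinePolynomial_succ (h : IsFixedSequence c b) (n : ℕ) :
    halfLinePolynomial (Function.update b 0 (-c)) c (n + 2)
      = -b (2 * n + 2) * halfLinePolynomial (Function.update b 0 (-c)) c (n + 1) := by
  set P := halfLinePolynomial (Function.update b 0 (-c)) c
  induction n with
  | zero =>
    have h1 := h.add 0
    rw [mul_zero, zero_add, zero_add, h.apply_one] at h1
    simp only [P, halfLinePolynomial, Function.update_self, mul_zero, zero_add]
    linear_combination c * h1
  | succ n ih =>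
    have e1 : P (n + 1 + 2) = c * P (n + 2) - b (n + 1) * P (n + 1) := by
      simp only [P]
      rw [halfLinePolynomial, Function.update_of_ne (Nat.succ_ne_zero n)]
    have h1 := h.mul (n + 1)
    have h2 := h.add (n + 1)
    rw [mul_add, mul_one] at h1 h2
    change P (n + 1 + 2) = -b (2 * n + 2 + 2) * P (n + 2)
    rw [e1, ← h1]
    linear_combination P (n + 2) * h2 - b (2 * n + 2 + 1) * ih

theorem halfLinePolynomial_eq_prod (h : IsFixedSequence c b) (n : ℕ) :
    halfLinePolynomial (Function.update b 0 (-c)) c (n + 1)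
      = c * ∏ k ∈ Finset.range n, -b (2 * (k + 1)) := by
  induction n with
  | zero => simp [halfLinePolynomial]
  | succ n ih =>
    rw [h.halfLinePolynomial_succ, ih, Finset.prod_range_succ, mul_add, mul_one]
    ring

/-- The orbit of `c` under `z ↦ z ^ 2 + c` in terms of the coefficients of the fixed point. -/
theorem iterate_mul (h : IsFixedSequence c b) (n : ℕ) :
    ‖(fun z : ℂ => z ^ 2 + c)^[n] c‖ * ‖b 0‖ = ‖c‖ * ∏ k ∈ Finset.range (2 ^ n), ‖b (2 * k)‖ := by
  have hup (k : ℕ) : Function.update b 0 (-c) (k + 1) = b (k + 1) :=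
    Function.update_of_ne (Nat.succ_ne_zero k) _ _
  rw [← halfLinePolynomial_two_pow (r := Function.update b 0 (-c)) (c := c)
    (Function.update_self _ _ _) (fun k => ?_) fun k => ?_]
  · obtain ⟨m, hm⟩ := Nat.exists_eq_succ_of_ne_zero (pow_ne_zero n (two_ne_zero (α := ℕ)))
    rw [hm, Nat.succ_eq_add_one, h.halfLinePolynomial_eq_prod, Finset.prod_range_succ', norm_mul,
      norm_prod]
    simp only [norm_neg, mul_zero]
    ring
  · rcases k with _ | k
    · rw [mul_zero, hup, zero_add, h.apply_one, mul_one]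
    · have e : 2 * (k + 1) = 2 * k + 1 + 1 := by ring
      rw [hup, hup, ← h.mul (k + 1), e, hup]
  · rw [hup, hup, h.add]

/-- Pairing neighbours by `b(2k) b(2k+1) = b(k)` halves the range until only `b 0` is left. -/
theorem prod_two_pow (h : IsFixedSequence c b) (n : ℕ) :
    ∏ k ∈ Finset.range (2 ^ n), b k = b 0 := by
  have key (m : ℕ) : ∏ k ∈ Finset.range (2 * m), b k = ∏ k ∈ Finset.range m, b k := by
    induction m with
    | zero => rfl
    | succ m ih =>
      rw [mul_add, mul_one, Finset.prod_range_succ, Finset.prod_range_succ, ih,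
        Finset.prod_range_succ, mul_assoc, h.mul]
  induction n with
  | zero => simp
  | succ n ih => rw [pow_succ', key, ih]

end IsFixedSequence

theorem CoeffConverges.exists_fixed {c : ℂ} (h : CoeffConverges c) :
    ∃ d, IsUnstableStep c d d := by
  obtain ⟨d, U, hU, Φ, hΦ, hlim⟩ := h
  have hdU := mem_of_mem_nhds hU
  exact ⟨d, isUnstableStep_of_tendsto (Φ := fun n => Φ n d) (hΦ d hdU).1 (hΦ d hdU).2
    (hlim.tendsto_at hdU)⟩

theorem IsUnstableStep.isFixedSequence {c : ℂ} {d : Coeff} (h : IsUnstableStep c d d) :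
    IsFixedSequence c fun n => d n ^ 2 where
  ne_zero n := by
    have := h.1.ne_zero n
    rw [evenPart_apply] at this
    push_cast
    exact pow_ne_zero 2 this
  mul n := by
    push_cast
    rw [← mul_pow, h.2]
  add n := by
    have h1 := h.1.riccati n
    have h2 := h.1.ne_zero n
    rw [evenPart_apply] at h2
    rw [ContinuousMap.pow_apply, ← h.2 n, evenPart_apply, evenPart_apply, mul_pow,
      mul_div_cancel_left₀ _ (pow_ne_zero 2 h2)] at h1
    rw [← h1]
    push_cast
    rw [mul_add, mul_one]

theorem not_coeffConverges_of_mem_mandelbrotSet {c : ℂ} (hc : c ∈ mandelbrotSet) :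
    ¬ CoeffConverges c := by
  intro hconv
  obtain ⟨d, hd⟩ := hconv.exists_fixed
  have hb := hd.isFixedSequence
  set b : ℕ → ℂ := fun n => d n ^ 2
  obtain ⟨K, ρ, hρ0, hρ1, hK, hexp⟩ := hd.1.exponential
  have hexp' (n : ℕ) : ∏ k ∈ Finset.range n, (‖b k‖ / ‖b (2 * k)‖ ^ 2) ≤ K * ρ ^ n := by
    refine le_trans (le_of_eq (Finset.prod_congr rfl fun k _ => ?_)) (hexp 0 n)
    simp only [b, zero_add, ContinuousMap.pow_apply, evenPart_apply, norm_pow, ← pow_mul]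
    push_cast
    rfl
  have hb0 : 0 < ‖b 0‖ := norm_pos_iff.2 (hb.ne_zero 0)
  -- For `c = 0` the orbit identity reads `0 = 0`. Instead `b(2n+2) = -b(2n+1)` makes the
  -- contraction product telescope to `‖b(2n)‖ / ‖b 0‖`, which is bounded below.
  rcases eq_or_ne c 0 with rfl | hc0
  · obtain ⟨m, hm, hm'⟩ := exists_pos_le_norm_of_ne_zero hd.1.ne_zero
    have tel (n : ℕ) : ∏ k ∈ Finset.range n, (‖b k‖ / ‖b (2 * k)‖ ^ 2) = ‖b (2 * n)‖ / ‖b 0‖ := by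
      induction n with
      | zero => rw [Finset.prod_range_zero, mul_zero, div_self hb0.ne']
      | succ n ih =>
        have h1 := hb.add n
        rw [neg_zero] at h1
        have h2 : ‖b (2 * (n + 1))‖ = ‖b (2 * n + 1)‖ := by
          rw [mul_add, mul_one, eq_neg_of_add_eq_zero_left h1, norm_neg]
        have h3 := norm_ne_zero_iff.2 (hb.ne_zero n)
        rw [Finset.prod_range_succ, ih, h2, ← hb.mul n, norm_mul]
        field_simp
    obtain ⟨n, hn⟩ := exists_mul_pow_le (K := K) hρ0 hρ1 (ε := m ^ 2 / ‖b 0‖ / 2) (by positivity)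
    have h1 := (hexp' n).trans hn
    rw [tel] at h1
    have h2 : m ^ 2 ≤ ‖b (2 * n)‖ := by
      have h3 := hm' n
      simp only [b, norm_pow, Nat.cast_mul, Nat.cast_ofNat]
      rw [evenPart_apply] at h3
      gcongr
    have h3 : m ^ 2 / ‖b 0‖ ≤ ‖b (2 * n)‖ / ‖b 0‖ := by gcongr
    have h4 : 0 < m ^ 2 / ‖b 0‖ := by positivity
    linarith
  · have hc' : Bornology.IsBounded (Set.range fun n : ℕ => (fun z : ℂ => z ^ 2 + c)^[n] 0) := hc
    obtain ⟨M, hM⟩ := hc'.exists_norm_le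
    have horb (n : ℕ) : ‖(fun z : ℂ => z ^ 2 + c)^[n] c‖ ≤ M := by
      have := hM _ ⟨n + 1, rfl⟩
      simpa [Function.iterate_succ_apply] using this
    have hcn : 0 < ‖c‖ := norm_pos_iff.2 hc0
    set B : ℝ := M * ‖b 0‖ / ‖c‖
    have hQ (n : ℕ) : ∏ k ∈ Finset.range (2 ^ n), ‖b (2 * k)‖ ≤ B := by
      rw [le_div_iff₀ hcn, mul_comm, ← hb.iterate_mul n]
      gcongr
      exact horb n
    -- The contraction product over `2 ^ n` steps equals `‖b 0‖` divided by the square of a product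
    -- that a bounded orbit keeps below `B`, so it cannot tend to zero.
    obtain ⟨n, hn⟩ := exists_mul_pow_le (K := B ^ 2 * K) hρ0 hρ1 (ε := ‖b 0‖ / 2) (by positivity)
    have h1 := hexp' (2 ^ n)
    have hpos : 0 < ∏ k ∈ Finset.range (2 ^ n), ‖b (2 * k)‖ :=
      Finset.prod_pos fun k _ => norm_pos_iff.2 (hb.ne_zero k)
    rw [Finset.prod_div_distrib, Finset.prod_pow, ← norm_prod (Finset.range (2 ^ n)) b,
      hb.prod_two_pow, div_le_iff₀ (pow_pos hpos 2)] at h1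
    have h2 : ρ ^ 2 ^ n ≤ ρ ^ n :=
      pow_le_pow_of_le_one hρ0.le hρ1.le Nat.lt_two_pow_self.le
    have h3 : ‖b 0‖ ≤ B ^ 2 * K * ρ ^ n := by
      calc ‖b 0‖ ≤ K * ρ ^ 2 ^ n * (∏ k ∈ Finset.range (2 ^ n), ‖b (2 * k)‖) ^ 2 := h1
        _ ≤ K * ρ ^ n * B ^ 2 :=
          mul_le_mul (mul_le_mul_of_nonneg_left h2 hK) (pow_le_pow_left₀ hpos.le (hQ n) 2)
            (sq_nonneg _) (mul_nonneg hK (pow_nonneg hρ0.le n))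
        _ = _ := by ring
    linarith

end

theorem mainTheorem2 (s : WeylBranch) :
    mandelbrotSet ⊆ jacobiMandelbrotSet s ∧ IsCompact (jacobiMandelbrotSet s) := by
  have e : jacobiMandelbrotSet s = {c | ¬ CoeffConverges c} := by
    ext c
    exact not_congr (renormalizationConverges_iff s c)
  rw [e]
  exact ⟨fun c hc => not_coeffConverges_of_mem_mandelbrotSet hc,
    Metric.isCompact_of_isClosed_isBounded isOpen_coeffConverges.isClosed_compl
      isBounded_not_coeffConverges⟩
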